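/- Let $k$ be a field of characteristic zero. All operads are nonunital symmetric operads in ($\mathbb Z$-)graded $k$-vector spaces: sequences $\mathcal S(n)$, $n\ge 1$, of graded vector spaces with linear $\Sigma_n$-actions and equivariant degree-zero partial compositions $\circ_i:\mathcal S(m)\otimes\mathcal S(n)\to\mathcal S(m+n-1)$, $1\le i\le n$ ($f\circ_i g$ inserts $f$ into the $i$-th input of $g$), satisfying the usual associativity axioms with Koszul signs. A differential on an operad is an equivariant degree $-1$ derivation $d$ with $d^2=0$, i.e. $d(f\circ_i g)=df\circ_i g+(-1)^{|f|}f\circ_i dg$. $\mathcal F(Z)$ denotes the free operad on a collection $Z=\{Z(n)\}_{n\ge2}$ of graded $\Sigma_n$-modules, and $\mathcal F^{l}(Z)$ its part spanned by words of length $l$ in the generators. If $Z=Z^0\oplus Z^1\oplus\cdots$ is a decomposition into subcollections, $\mathcal F(Z)^k$ denotes the part spanned by words whose generators have upper degrees of sum $k$, and $\mathcal F(Z)^{\le m}=\bigoplus_{k\le m}\mathcal F(Z)^k$ (which is $0$ if $m<0$). If a differential $d$ on $\mathcal F(Z)$ is homogeneous of degree $-1$ for the upper grading, its homology inherits an upper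 grading $\mathcal H^k(\mathcal F(Z),d)$. A TJ-model (bigraded model) of an operad $\mathcal H$ with $\mathcal H(1)=0$ is a collection $Z=Z^0\oplus Z^1\oplus\cdots$, a differential $d$ on $\mathcal F(Z)$ with $d(Z^0)=0$ and $d(Z^k)\subset\mathcal F(Z)^{k-1}$ for $k\ge1$, and a homomorphism $\rho:(\mathcal F(Z),d)\to(\mathcal H,0)$ of differential operads such that (a) $d(Z)\subset\mathcal F^{\ge2}(Z)$; (b) $\rho|_{Z^{\ge1}}=0$ and $\rho$ induces an isomorphism $\mathcal H^0(\mathcal F(Z),d)\cong\mathcal H$; (c) $\mathcal H^{\ge1}(\mathcal F(Z),d)=0$. **Theorem.** Let $(\mathcal S,d_{\mathcal S})$ be a differential operad with $\mathcal S(1)=0$, let $\mathcal H=\mathcal H(\mathcal S,d_{\mathcal S})$ be its homology operad, and let $\rho:(\mathcal F(Z),d)\to(\mathcal H,0)$ be a TJ-model of $\mathcal H$. Then there exist a differential $D$ on $\mathcal F(Z)$ and a homomorphism $\alpha:(\mathcal F(Z),D)\to(\mathcal S,d_{\mathcal S})$ of differential operads such that 1. $(D-d)(Z^k)\subset\mathcal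 F(Z)^{\le k-2}$ for every $k\ge0$, and 2. $\alpha$ induces an isomorphism $\mathcal H(\alpha):\mathcal H(\mathcal F(Z),D)\to\mathcal H(\mathcal S,d_{\mathcal S})$. (Such an $\alpha:(\mathcal F(Z),D)\to(\mathcal S,d_{\mathcal S})$ is called a filtered model of $(\mathcal S,d_{\mathcal S})$.) -/

import Mathlib

/-!
Nonunital differential graded operads over a field, the free operad, homology operads, bigraded
(Tate–Jozefiak) models.

Conventions.  An arity `m ≥ 1` is encoded by the natural number `m - 1`: the component `obj n p` of
a collection is its part of arity `n + 1` and inner degree `p : ℤ`, on which the symmetric group of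
`Fin (n + 1)` acts from the left.  Inputs are numbered from `0`.  A graded vector space is the
family of its homogeneous parts.  Operations depending on an equation between arities or degrees
take the equation as an argument, so that no transport along equalities is needed.
-/

universe u v w

namespace OperadModels

/-- The sign `(-1)^n` in the field `k`. -/
def sgn (k : Type u) [Field k] (n : ℤ) : k := ((n.negOnePow : ℤ) : k)

section Permutations

/-- Replacing the input `i` of an operation with `b + 1` inputs by an operation with `a + 1` inputs
gives an operation with `c + 1 = a + b + 1` inputs.  These are the inputs of the inserted
operation (the block `i, …, i + a`) together with the inputs `s ≠ i` of the outer operation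
(`s < i` keeps its number, `s > i` becomes `s + a`). -/
def blockFun {a b c : ℕ} (h : a + b = c) (i : Fin (b + 1)) :
    Fin (a + 1) ⊕ {s : Fin (b + 1) // s ≠ i} → Fin (c + 1) :=
  Sum.elim (fun t => ⟨i.1 + t.1, by omega⟩)
    (fun s => if s.1.1 < i.1 then ⟨s.1.1, by omega⟩ else ⟨s.1.1 + a, by omega⟩)

theorem blockFun_bijective {a b c : ℕ} (h : a + b = c) (i : Fin (b + 1)) :
    Function.Bijective (blockFun h i) := by
  rw [Fintype.bijective_iff_injective_and_card]
  constructor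
  · rintro (t | ⟨s, hs⟩) (t' | ⟨s', hs'⟩) hx
    · simp only [blockFun, Sum.elim_inl, Fin.mk.injEq] at hx
      congr 1
      ext
      omega
    · exfalso
      have hs'' : s'.1 ≠ i.1 := fun e => hs' (Fin.ext e)
      simp only [blockFun, Sum.elim_inl, Sum.elim_inr] at hx
      split_ifs at hx <;> simp only [Fin.mk.injEq] at hx <;> omega
    · exfalso
      have hs'' : s.1 ≠ i.1 := fun e => hs (Fin.ext e)
      simp only [blockFun, Sum.elim_inl, Sum.elim_inr] at hx
      split_ifs at hx <;> simp only [Fin.mk.injEq] at hx <;> omega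
    · have hs1 : s.1 ≠ i.1 := fun e => hs (Fin.ext e)
      have hs2 : s'.1 ≠ i.1 := fun e => hs' (Fin.ext e)
      simp only [blockFun, Sum.elim_inr] at hx
      congr 1
      apply Subtype.ext
      ext
      show s.1 = s'.1
      split_ifs at hx <;> simp only [Fin.mk.injEq] at hx <;> omega
  · simp only [Fintype.card_sum, Fintype.card_fin, Fintype.card_subtype_compl,
      Fintype.card_unique]
    omega

/-- `blockFun` as an equivalence. -/
noncomputable def blockEquiv {a b c : ℕ} (h : a + b = c) (i : Fin (b + 1)) :
    Fin (a + 1) ⊕ {s : Fin (b + 1) // s ≠ i} ≃ Fin (c + 1) :=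
  Equiv.ofBijective (blockFun h i) (blockFun_bijective h i)

/-- The permutation obtained by inserting `σ` at the place `i` in `τ`: it carries the block of
inputs at the place `τ⁻¹ i` to the block at the place `i` by `σ`, and the remaining inputs as `τ`
does. -/
noncomputable def insertPerm {a b c : ℕ} (h : a + b = c) (σ : Equiv.Perm (Fin (a + 1)))
    (τ : Equiv.Perm (Fin (b + 1))) (i : Fin (b + 1)) : Equiv.Perm (Fin (c + 1)) :=
  (blockEquiv h (τ⁻¹ i)).symm.trans
    ((Equiv.sumCongr σ
      (τ.subtypeEquiv fun s => not_congr (by rw [Equiv.Perm.eq_inv_iff_eq]))).trans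
        (blockEquiv h i))

end Permutations

/-- Sequences of graded vector spaces `E(n)`, `n ≥ 1`, with linear degree-preserving left actions
of the symmetric groups. -/
structure Collection (k : Type u) [Field k] : Type (max u (v + 1)) where
  /-- the part of arity `n + 1` and inner degree `p` -/
  obj : ℕ → ℤ → Type v
  [addCommGroup : ∀ n p, AddCommGroup (obj n p)]
  [module : ∀ n p, Module k (obj n p)]
  /-- the action of the symmetric group -/
  act : ∀ n p, Representation k (Equiv.Perm (Fin (n + 1))) (obj n p)

attribute [instance] Collection.addCommGroup Collection.module

/-- `E(1) = 0`. -/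
def Collection.Reduced {k : Type u} [Field k] (E : Collection.{u, v} k) : Prop :=
  ∀ p, Subsingleton (E.obj 0 p)

/-- A decomposition `E = E^0 ⊕ E^1 ⊕ ⋯` into invariant graded subspaces; `piece j` is `E^j`. -/
structure Collection.Decomposition {k : Type u} [Field k] (E : Collection.{u, v} k) where
  /-- the summand `E^j` -/
  piece : ℕ → ∀ n p, Submodule k (E.obj n p)
  act_mem : ∀ j n p (σ : Equiv.Perm (Fin (n + 1))), ∀ x ∈ piece j n p,
    E.act n p σ x ∈ piece j n p
  isInternal : ∀ n p, DirectSum.IsInternal fun j => piece j n p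

/-- A nonunital (graded, symmetric) operad.  `circ _ i _ f g` is `f ∘ᵢ g`, the operation in which
`f` is inserted into the input `i` of `g`. -/
structure Operad (k : Type u) [Field k] : Type (max u (v + 1)) extends Collection.{u, v} k where
  /-- the composition `f ∘ᵢ g` -/
  circ : ∀ {a b c : ℕ} (_ : a + b = c) (_ : Fin (b + 1)) {p q r : ℤ} (_ : p + q = r),
    obj a p →ₗ[k] obj b q →ₗ[k] obj c r
  /-- `f ∘ᵢ₊ⱼ (g ∘ⱼ h) = (f ∘ᵢ g) ∘ⱼ h` for an input `i` of `g` and an input `j` of `h` -/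
  assoc_nested : ∀ {a b c ab bc abc : ℕ} (hab : a + b = ab) (hbc : b + c = bc)
    (h₁ : a + bc = abc) (h₂ : ab + c = abc) {p q r pq qr pqr : ℤ} (hpq : p + q = pq)
    (hqr : q + r = qr) (h₃ : p + qr = pqr) (h₄ : pq + r = pqr)
    (i : Fin (b + 1)) (j : Fin (c + 1)) (f : obj a p) (g : obj b q) (h : obj c r),
    circ h₁ ⟨i.1 + j.1, by omega⟩ h₃ f (circ hbc j hqr g h) =
      circ h₂ j h₄ (circ hab i hpq f g) h
  /-- `f ∘ᵢ (g ∘ⱼ h) = (-1)^(|f||g|) g ∘ⱼ₊ₐ (f ∘ᵢ h)` for inputs `i < j` of `h`, where `f` has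
  `a + 1` inputs.  (The case of inputs `i > j` of `h` is this equation with `f`, `g` exchanged.) -/
  assoc_parallel : ∀ {a b c ac bc abc : ℕ} (hac : a + c = ac) (hbc : b + c = bc)
    (h₁ : a + bc = abc) (h₂ : b + ac = abc) {p q r pr qr pqr : ℤ} (hpr : p + r = pr)
    (hqr : q + r = qr) (h₃ : p + qr = pqr) (h₄ : q + pr = pqr)
    (i j : Fin (c + 1)) (_ : i < j) (f : obj a p) (g : obj b q) (h : obj c r),
    circ h₁ ⟨i.1, by omega⟩ h₃ f (circ hbc j hqr g h) =
      sgn k (p * q) • circ h₂ ⟨j.1 + a, by omega⟩ h₄ g (circ hac i hpr f h)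
  /-- the compositions are equivariant -/
  circ_act : ∀ {a b c : ℕ} (h : a + b = c) (i : Fin (b + 1)) {p q r : ℤ} (hr : p + q = r)
    (σ : Equiv.Perm (Fin (a + 1))) (τ : Equiv.Perm (Fin (b + 1))) (f : obj a p) (g : obj b q),
    circ h i hr (act a p σ f) (act b q τ g) =
      act c r (insertPerm h σ τ i) (circ h (τ⁻¹ i) hr f g)

/-- Homomorphisms of operads. -/
structure Operad.Hom {k : Type u} [Field k] (S : Operad.{u, v} k) (T : Operad.{u, w} k) where
  /-- the components -/
  map : ∀ n p, S.obj n p →ₗ[k] T.obj n p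
  map_act : ∀ n p (σ : Equiv.Perm (Fin (n + 1))) (x : S.obj n p),
    map n p (S.act n p σ x) = T.act n p σ (map n p x)
  map_circ : ∀ {a b c : ℕ} (h : a + b = c) (i : Fin (b + 1)) {p q r : ℤ} (hr : p + q = r)
    (f : S.obj a p) (g : S.obj b q),
    map c r (S.circ h i hr f g) = T.circ h i hr (map a p f) (map b q g)

/-- A differential on an operad: a derivation of degree `-1` and square zero. -/
structure Operad.Differential {k : Type u} [Field k] (S : Operad.{u, v} k) where
  /-- the components, from degree `p` to degree `q = p - 1` -/
  d : ∀ n p q, q + 1 = p → (S.obj n p →ₗ[k] S.obj n q)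
  d_act : ∀ n p q (h : q + 1 = p) (σ : Equiv.Perm (Fin (n + 1))) (x : S.obj n p),
    d n p q h (S.act n p σ x) = S.act n q σ (d n p q h x)
  d_circ : ∀ {a b c : ℕ} (h : a + b = c) (i : Fin (b + 1)) {p q r p' q' r' : ℤ} (hr : p + q = r)
    (hp : p' + 1 = p) (hq : q' + 1 = q) (hr' : r' + 1 = r) (f : S.obj a p) (g : S.obj b q),
    d c r r' hr' (S.circ h i hr f g) =
      S.circ h i (by omega) (d a p p' hp f) g +
        sgn k p • S.circ h i (by omega) f (d b q q' hq g)
  d_d : ∀ n p q r (hq : q + 1 = p) (hr : r + 1 = q) (x : S.obj n p),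
    d n q r hr (d n p q hq x) = 0

/-- The trivial differential. -/
def Operad.zeroDifferential {k : Type u} [Field k] (S : Operad.{u, v} k) : S.Differential where
  d _ _ _ _ := 0
  d_act := by simp
  d_circ := by simp
  d_d := by simp

/-- Homomorphisms `(S, dS) → (T, dT)` of differential operads. -/
structure DGHom {k : Type u} [Field k] {S : Operad.{u, v} k} {T : Operad.{u, w} k}
    (dS : S.Differential) (dT : T.Differential) extends Operad.Hom S T where
  map_d : ∀ n p q (h : q + 1 = p) (x : S.obj n p),
    map n q (dS.d n p q h x) = dT.d n p q h (map n p x)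

section Homology

variable {k : Type u} [Field k] {S : Operad.{u, v} k} (d : S.Differential)

/-- The cycles of arity `n + 1` and degree `p`. -/
def Operad.Differential.cycles (n : ℕ) (p : ℤ) : Submodule k (S.obj n p) :=
  LinearMap.ker (d.d n p (p - 1) (by omega))

/-- The boundaries of arity `n + 1` and degree `p`, as a subspace of the cycles. -/
def Operad.Differential.boundaries (n : ℕ) (p : ℤ) : Submodule k (d.cycles n p) :=
  (LinearMap.range (d.d n (p + 1) p rfl)).comap (d.cycles n p).subtype

theorem Operad.Differential.mem_cycles {n : ℕ} {p : ℤ} {x : S.obj n p} :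
    x ∈ d.cycles n p ↔ ∀ q (h : q + 1 = p), d.d n p q h x = 0 := by
  constructor
  · intro hx q h
    obtain rfl : q = p - 1 := by omega
    exact hx
  · intro hx
    exact hx _ _

theorem Operad.Differential.mem_boundaries {n : ℕ} {p : ℤ} {x : d.cycles n p} :
    x ∈ d.boundaries n p ↔ ∃ y, d.d n (p + 1) p rfl y = x.1 := Iff.rfl

theorem Operad.Differential.act_mem_cycles {n : ℕ} {p : ℤ} (σ : Equiv.Perm (Fin (n + 1)))
    (x : S.obj n p) (hx : x ∈ d.cycles n p) : S.act n p σ x ∈ d.cycles n p := by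
  rw [d.mem_cycles] at hx ⊢
  intro q h
  rw [d.d_act, hx q h, map_zero]

theorem Operad.Differential.circ_mem_cycles {a b c : ℕ} (h : a + b = c) (i : Fin (b + 1))
    {p q r : ℤ} (hr : p + q = r) {x : S.obj a p} (hx : x ∈ d.cycles a p) {y : S.obj b q}
    (hy : y ∈ d.cycles b q) : S.circ h i hr x y ∈ d.cycles c r := by
  rw [d.mem_cycles] at hx hy ⊢
  intro r' h'
  rw [d.d_circ h i hr (p' := p - 1) (q' := q - 1) (by omega) (by omega) h', hx, hy]
  simp

/-- The vector space `ker d / im d` in arity `n + 1` and degree `p`. -/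
abbrev Operad.Differential.HomologyObj (n : ℕ) (p : ℤ) : Type v :=
  d.cycles n p ⧸ d.boundaries n p

/-- The action of the symmetric group on cycles. -/
def Operad.Differential.cyclesAct (n : ℕ) (p : ℤ) (σ : Equiv.Perm (Fin (n + 1))) :
    d.cycles n p →ₗ[k] d.cycles n p :=
  (S.act n p σ).restrict (d.act_mem_cycles σ)

theorem Operad.Differential.boundaries_le_comap_act (n : ℕ) (p : ℤ)
    (σ : Equiv.Perm (Fin (n + 1))) :
    d.boundaries n p ≤ (d.boundaries n p).comap (d.cyclesAct n p σ) := by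
  rintro x ⟨y, hy⟩
  exact ⟨S.act n (p + 1) σ y, by rw [d.d_act, hy]; rfl⟩

/-- The action of the symmetric group on homology. -/
def Operad.Differential.homologyAct (n : ℕ) (p : ℤ) :
    Representation k (Equiv.Perm (Fin (n + 1))) (d.HomologyObj n p) where
  toFun σ := (d.boundaries n p).mapQ (d.boundaries n p) (d.cyclesAct n p σ)
    (d.boundaries_le_comap_act n p σ)
  map_one' := by
    apply Submodule.linearMap_qext
    ext x
    simp [Operad.Differential.cyclesAct, LinearMap.restrict_apply]
  map_mul' σ τ := by
    apply Submodule.linearMap_qext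
    ext x
    simp [Operad.Differential.cyclesAct, LinearMap.restrict_apply]

/-- The composition of cycles, with values in homology. -/
def Operad.Differential.cyclesCirc {a b c : ℕ} (h : a + b = c) (i : Fin (b + 1))
    {p q r : ℤ} (hr : p + q = r) :
    d.cycles a p →ₗ[k] d.cycles b q →ₗ[k] d.HomologyObj c r :=
  LinearMap.mk₂ k
    (fun x y => (d.boundaries c r).mkQ ⟨S.circ h i hr x y, d.circ_mem_cycles h i hr x.2 y.2⟩)
    (fun x x' y => by rw [← map_add]; congr 1; ext; simp)
    (fun t x y => by rw [← map_smul]; congr 1; ext; simp)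
    (fun x y y' => by rw [← map_add]; congr 1; ext; simp)
    (fun t x y => by rw [← map_smul]; congr 1; ext; simp)

theorem Operad.Differential.cyclesCirc_left {a b c : ℕ} (h : a + b = c) (i : Fin (b + 1))
    {p q r : ℤ} (hr : p + q = r) (x : d.cycles a p) (hx : x ∈ d.boundaries a p)
    (y : d.cycles b q) : d.cyclesCirc h i hr x y = 0 := by
  obtain ⟨z, hz⟩ := hx
  refine (Submodule.Quotient.mk_eq_zero _).2 ⟨S.circ h i (by omega) z y.1, ?_⟩
  rw [d.d_circ h i (p := p + 1) (q := q) (p' := p) (q' := q - 1) (by omega) rfl (by omega) rfl,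
    (d.mem_cycles.1 y.2) _ _, hz]
  simp

theorem Operad.Differential.cyclesCirc_right {a b c : ℕ} (h : a + b = c) (i : Fin (b + 1))
    {p q r : ℤ} (hr : p + q = r) (x : d.cycles a p) (y : d.cycles b q)
    (hy : y ∈ d.boundaries b q) : d.cyclesCirc h i hr x y = 0 := by
  obtain ⟨z, hz⟩ := hy
  refine (Submodule.Quotient.mk_eq_zero _).2 ⟨sgn k p • S.circ h i (by omega) x.1 z, ?_⟩
  rw [map_smul, d.d_circ h i (p := p) (q := q + 1) (p' := p - 1) (q' := q) (by omega) (by omega)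
    rfl rfl, (d.mem_cycles.1 x.2) _ _, hz]
  have hs : sgn k p * sgn k p = 1 := by
    unfold sgn
    rw [← Int.cast_mul, ← Units.val_mul]
    simp
  simp [smul_smul, hs]

/-- The composition in homology. -/
def Operad.Differential.homologyCirc {a b c : ℕ} (h : a + b = c) (i : Fin (b + 1))
    {p q r : ℤ} (hr : p + q = r) :
    d.HomologyObj a p →ₗ[k] d.HomologyObj b q →ₗ[k] d.HomologyObj c r :=
  (d.boundaries a p).liftQ
    { toFun := fun x => (d.boundaries b q).liftQ (d.cyclesCirc h i hr x)
        (fun y hy => d.cyclesCirc_right h i hr x y hy)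
      map_add' := fun x x' => by
        apply Submodule.linearMap_qext
        ext y
        exact LinearMap.congr_fun (map_add (d.cyclesCirc h i hr) x x') y
      map_smul' := fun t x => by
        apply Submodule.linearMap_qext
        ext y
        exact LinearMap.congr_fun (map_smul (d.cyclesCirc h i hr) t x) y }
    (fun x hx => by
      apply Submodule.linearMap_qext
      ext y
      exact d.cyclesCirc_left h i hr x hx y)

/-- The homology operad `H(S, d)`. -/
def Operad.Differential.homology : Operad.{u, v} k where
  obj n p := d.HomologyObj n p
  act := d.homologyAct
  circ := d.homologyCirc
  assoc_nested := by
    intro a b c ab bc abc hab hbc h₁ h₂ p q r pq qr pqr hpq hqr h₃ h₄ i j f g h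
    obtain ⟨f, rfl⟩ := Submodule.Quotient.mk_surjective _ f
    obtain ⟨g, rfl⟩ := Submodule.Quotient.mk_surjective _ g
    obtain ⟨h, rfl⟩ := Submodule.Quotient.mk_surjective _ h
    refine congrArg (d.boundaries abc pqr).mkQ (Subtype.ext ?_)
    exact S.assoc_nested hab hbc h₁ h₂ hpq hqr h₃ h₄ i j f.1 g.1 h.1
  assoc_parallel := by
    intro a b c ac bc abc hac hbc h₁ h₂ p q r pr qr pqr hpr hqr h₃ h₄ i j hij f g h
    obtain ⟨f, rfl⟩ := Submodule.Quotient.mk_surjective _ f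
    obtain ⟨g, rfl⟩ := Submodule.Quotient.mk_surjective _ g
    obtain ⟨h, rfl⟩ := Submodule.Quotient.mk_surjective _ h
    refine congrArg (d.boundaries abc pqr).mkQ (Subtype.ext ?_)
    exact S.assoc_parallel hac hbc h₁ h₂ hpr hqr h₃ h₄ i j hij f.1 g.1 h.1
  circ_act := by
    intro a b c h i p q r hr σ τ f g
    obtain ⟨f, rfl⟩ := Submodule.Quotient.mk_surjective _ f
    obtain ⟨g, rfl⟩ := Submodule.Quotient.mk_surjective _ g
    refine congrArg (d.boundaries c r).mkQ (Subtype.ext ?_)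
    exact S.circ_act h i hr σ τ f.1 g.1

/-- The homology class of a cycle. -/
def Operad.Differential.cl (n : ℕ) (p : ℤ) : d.cycles n p →ₗ[k] d.homology.obj n p :=
  (d.boundaries n p).mkQ

end Homology

section HomologyHom

variable {k : Type u} [Field k] {S : Operad.{u, v} k} {T : Operad.{u, w} k}
  {dS : S.Differential} {dT : T.Differential} (φ : DGHom dS dT)

theorem DGHom.map_mem_cycles (n : ℕ) (p : ℤ) (x : S.obj n p) (hx : x ∈ dS.cycles n p) :
    φ.map n p x ∈ dT.cycles n p := by
  rw [dT.mem_cycles]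
  intro q h
  rw [← φ.map_d, (dS.mem_cycles.1 hx) q h, map_zero]

/-- The map induced on cycles. -/
def DGHom.cyclesMap (n : ℕ) (p : ℤ) : dS.cycles n p →ₗ[k] dT.cycles n p :=
  (φ.map n p).restrict (φ.map_mem_cycles n p)

theorem DGHom.boundaries_le_comap (n : ℕ) (p : ℤ) :
    dS.boundaries n p ≤ (dT.boundaries n p).comap (φ.cyclesMap n p) := by
  rintro x ⟨y, hy⟩
  exact ⟨φ.map n (p + 1) y, by rw [← φ.map_d, hy]; rfl⟩

/-- The homomorphism `H(φ) : H(S, dS) → H(T, dT)` of homology operads. -/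
def DGHom.homologyHom : Operad.Hom dS.homology dT.homology where
  map n p := (dS.boundaries n p).mapQ (dT.boundaries n p) (φ.cyclesMap n p)
    (φ.boundaries_le_comap n p)
  map_act := by
    intro n p σ x
    obtain ⟨x, rfl⟩ := Submodule.Quotient.mk_surjective _ x
    exact congrArg (dT.boundaries n p).mkQ (Subtype.ext (φ.map_act n p σ x.1))
  map_circ := by
    intro a b c h i p q r hr f g
    obtain ⟨f, rfl⟩ := Submodule.Quotient.mk_surjective _ f
    obtain ⟨g, rfl⟩ := Submodule.Quotient.mk_surjective _ g
    exact congrArg (dT.boundaries c r).mkQ (Subtype.ext (φ.map_circ h i hr f.1 g.1))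

end HomologyHom

section Free

variable {k : Type u} [Field k] (E : Collection.{u, v} k)

/-- Formal expressions in elements of the collection `E` and the operations of an operad. -/
inductive Pre : ℕ → ℤ → Type (max u v)
  | of {n : ℕ} {p : ℤ} (e : E.obj n p) : Pre n p
  | zero {n : ℕ} {p : ℤ} : Pre n p
  | add {n : ℕ} {p : ℤ} (x y : Pre n p) : Pre n p
  | smul {n : ℕ} {p : ℤ} (t : k) (x : Pre n p) : Pre n p
  | act {n : ℕ} {p : ℤ} (σ : Equiv.Perm (Fin (n + 1))) (x : Pre n p) : Pre n p
  | circ {a b c : ℕ} (h : a + b = c) (i : Fin (b + 1)) {p q r : ℤ} (hr : p + q = r)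
      (x : Pre a p) (y : Pre b q) : Pre c r

/-- The congruence on formal expressions generated by the linear and equivariant structure of `E`
and the axioms of an operad. -/
inductive Rel : ∀ {n : ℕ} {p : ℤ}, Pre E n p → Pre E n p → Prop
  | refl {n : ℕ} {p : ℤ} (x : Pre E n p) : Rel x x
  | symm {n : ℕ} {p : ℤ} {x y : Pre E n p} : Rel x y → Rel y x
  | trans {n : ℕ} {p : ℤ} {x y z : Pre E n p} : Rel x y → Rel y z → Rel x z
  | add_congr {n : ℕ} {p : ℤ} {x x' y y' : Pre E n p} :
      Rel x x' → Rel y y' → Rel (.add x y) (.add x' y')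
  | smul_congr {n : ℕ} {p : ℤ} (t : k) {x x' : Pre E n p} :
      Rel x x' → Rel (.smul t x) (.smul t x')
  | act_congr {n : ℕ} {p : ℤ} (σ : Equiv.Perm (Fin (n + 1))) {x x' : Pre E n p} :
      Rel x x' → Rel (.act σ x) (.act σ x')
  | circ_congr {a b c : ℕ} (h : a + b = c) (i : Fin (b + 1)) {p q r : ℤ} (hr : p + q = r)
      {x x' : Pre E a p} {y y' : Pre E b q} :
      Rel x x' → Rel y y' → Rel (.circ h i hr x y) (.circ h i hr x' y')
  | add_assoc {n : ℕ} {p : ℤ} (x y z : Pre E n p) :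
      Rel (.add (.add x y) z) (.add x (.add y z))
  | add_comm {n : ℕ} {p : ℤ} (x y : Pre E n p) : Rel (.add x y) (.add y x)
  | zero_add {n : ℕ} {p : ℤ} (x : Pre E n p) : Rel (.add .zero x) x
  | smul_add {n : ℕ} {p : ℤ} (t : k) (x y : Pre E n p) :
      Rel (.smul t (.add x y)) (.add (.smul t x) (.smul t y))
  | add_smul {n : ℕ} {p : ℤ} (s t : k) (x : Pre E n p) :
      Rel (.smul (s + t) x) (.add (.smul s x) (.smul t x))
  | mul_smul {n : ℕ} {p : ℤ} (s t : k) (x : Pre E n p) :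
      Rel (.smul (s * t) x) (.smul s (.smul t x))
  | one_smul {n : ℕ} {p : ℤ} (x : Pre E n p) : Rel (.smul 1 x) x
  | zero_smul {n : ℕ} {p : ℤ} (x : Pre E n p) : Rel (.smul 0 x) .zero
  | of_add {n : ℕ} {p : ℤ} (e e' : E.obj n p) : Rel (.of (e + e')) (.add (.of e) (.of e'))
  | of_smul {n : ℕ} {p : ℤ} (t : k) (e : E.obj n p) : Rel (.of (t • e)) (.smul t (.of e))
  | of_act {n : ℕ} {p : ℤ} (σ : Equiv.Perm (Fin (n + 1))) (e : E.obj n p) :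
      Rel (.of (E.act n p σ e)) (.act σ (.of e))
  | act_add {n : ℕ} {p : ℤ} (σ : Equiv.Perm (Fin (n + 1))) (x y : Pre E n p) :
      Rel (.act σ (.add x y)) (.add (.act σ x) (.act σ y))
  | act_smul {n : ℕ} {p : ℤ} (σ : Equiv.Perm (Fin (n + 1))) (t : k) (x : Pre E n p) :
      Rel (.act σ (.smul t x)) (.smul t (.act σ x))
  | act_one {n : ℕ} {p : ℤ} (x : Pre E n p) : Rel (.act 1 x) x
  | act_mul {n : ℕ} {p : ℤ} (σ τ : Equiv.Perm (Fin (n + 1))) (x : Pre E n p) :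
      Rel (.act (σ * τ) x) (.act σ (.act τ x))
  | add_circ {a b c : ℕ} (h : a + b = c) (i : Fin (b + 1)) {p q r : ℤ} (hr : p + q = r)
      (x x' : Pre E a p) (y : Pre E b q) :
      Rel (.circ h i hr (.add x x') y) (.add (.circ h i hr x y) (.circ h i hr x' y))
  | smul_circ {a b c : ℕ} (h : a + b = c) (i : Fin (b + 1)) {p q r : ℤ} (hr : p + q = r)
      (t : k) (x : Pre E a p) (y : Pre E b q) :
      Rel (.circ h i hr (.smul t x) y) (.smul t (.circ h i hr x y))
  | circ_add {a b c : ℕ} (h : a + b = c) (i : Fin (b + 1)) {p q r : ℤ} (hr : p + q = r)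
      (x : Pre E a p) (y y' : Pre E b q) :
      Rel (.circ h i hr x (.add y y')) (.add (.circ h i hr x y) (.circ h i hr x y'))
  | circ_smul {a b c : ℕ} (h : a + b = c) (i : Fin (b + 1)) {p q r : ℤ} (hr : p + q = r)
      (t : k) (x : Pre E a p) (y : Pre E b q) :
      Rel (.circ h i hr x (.smul t y)) (.smul t (.circ h i hr x y))
  | assoc_nested {a b c ab bc abc : ℕ} (hab : a + b = ab) (hbc : b + c = bc)
      (h₁ : a + bc = abc) (h₂ : ab + c = abc) {p q r pq qr pqr : ℤ} (hpq : p + q = pq)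
      (hqr : q + r = qr) (h₃ : p + qr = pqr) (h₄ : pq + r = pqr)
      (i : Fin (b + 1)) (j : Fin (c + 1)) (f : Pre E a p) (g : Pre E b q) (h : Pre E c r) :
      Rel (.circ h₁ ⟨i.1 + j.1, by omega⟩ h₃ f (.circ hbc j hqr g h))
        (.circ h₂ j h₄ (.circ hab i hpq f g) h)
  | assoc_parallel {a b c ac bc abc : ℕ} (hac : a + c = ac) (hbc : b + c = bc)
      (h₁ : a + bc = abc) (h₂ : b + ac = abc) {p q r pr qr pqr : ℤ} (hpr : p + r = pr)
      (hqr : q + r = qr) (h₃ : p + qr = pqr) (h₄ : q + pr = pqr)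
      (i j : Fin (c + 1)) (hij : i < j) (f : Pre E a p) (g : Pre E b q) (h : Pre E c r) :
      Rel (.circ h₁ ⟨i.1, by omega⟩ h₃ f (.circ hbc j hqr g h))
        (.smul (sgn k (p * q)) (.circ h₂ ⟨j.1 + a, by omega⟩ h₄ g (.circ hac i hpr f h)))
  | circ_act {a b c : ℕ} (h : a + b = c) (i : Fin (b + 1)) {p q r : ℤ} (hr : p + q = r)
      (σ : Equiv.Perm (Fin (a + 1))) (τ : Equiv.Perm (Fin (b + 1)))
      (f : Pre E a p) (g : Pre E b q) :
      Rel (.circ h i hr (.act σ f) (.act τ g))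
        (.act (insertPerm h σ τ i) (.circ h (τ⁻¹ i) hr f g))

/-- The congruence as a setoid. -/
def preSetoid (n : ℕ) (p : ℤ) : Setoid (Pre E n p) :=
  ⟨Rel E, Rel.refl, Rel.symm, Rel.trans⟩

/-- The part of arity `n + 1` and degree `p` of the free operad on `E`. -/
def FreeObj (n : ℕ) (p : ℤ) : Type (max u v) := Quotient (preSetoid E n p)

namespace FreeObj

variable {E} {n : ℕ} {p : ℤ}

/-- The class of a formal expression. -/
def mk (x : Pre E n p) : FreeObj E n p := Quotient.mk (preSetoid E n p) x

theorem sound {x y : Pre E n p} (h : Rel E x y) : mk x = mk y := Quotient.sound h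

theorem mk_surjective (x : FreeObj E n p) : ∃ y, mk y = x := Quotient.exists_rep x

instance : Add (FreeObj E n p) :=
  ⟨Quotient.map₂ Pre.add fun _ _ h _ _ h' => Rel.add_congr h h'⟩

instance : Zero (FreeObj E n p) := ⟨mk Pre.zero⟩

instance : SMul k (FreeObj E n p) :=
  ⟨fun t => Quotient.map (Pre.smul t) fun _ _ h => Rel.smul_congr t h⟩

instance : AddCommMonoid (FreeObj E n p) where
  add_assoc x y z := by
    obtain ⟨x, rfl⟩ := mk_surjective x
    obtain ⟨y, rfl⟩ := mk_surjective y
    obtain ⟨z, rfl⟩ := mk_surjective z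
    exact sound (Rel.add_assoc x y z)
  add_comm x y := by
    obtain ⟨x, rfl⟩ := mk_surjective x
    obtain ⟨y, rfl⟩ := mk_surjective y
    exact sound (Rel.add_comm x y)
  zero_add x := by
    obtain ⟨x, rfl⟩ := mk_surjective x
    exact sound (Rel.zero_add x)
  add_zero x := by
    obtain ⟨x, rfl⟩ := mk_surjective x
    exact sound ((Rel.add_comm _ _).trans (Rel.zero_add x))
  nsmul := nsmulRec

instance instModule : Module k (FreeObj E n p) where
  one_smul x := by
    obtain ⟨x, rfl⟩ := mk_surjective x
    exact sound (Rel.one_smul x)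
  mul_smul s t x := by
    obtain ⟨x, rfl⟩ := mk_surjective x
    exact sound (Rel.mul_smul s t x)
  smul_add t x y := by
    obtain ⟨x, rfl⟩ := mk_surjective x
    obtain ⟨y, rfl⟩ := mk_surjective y
    exact sound (Rel.smul_add t x y)
  add_smul s t x := by
    obtain ⟨x, rfl⟩ := mk_surjective x
    exact sound (Rel.add_smul s t x)
  zero_smul x := by
    obtain ⟨x, rfl⟩ := mk_surjective x
    exact sound (Rel.zero_smul x)
  smul_zero t := by
    refine sound (Rel.trans (Rel.smul_congr t (Rel.zero_smul Pre.zero).symm) ?_)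
    refine Rel.trans (Rel.mul_smul t 0 _).symm ?_
    rw [mul_zero]
    exact Rel.zero_smul _

instance : Neg (FreeObj E n p) := ⟨fun x => (-1 : k) • x⟩

instance : AddCommGroup (FreeObj E n p) :=
  { (inferInstance : AddCommMonoid (FreeObj E n p)) with
    zsmul := zsmulRec
    neg_add_cancel := fun x => by
      show (-1 : k) • x + x = 0
      nth_rewrite 2 [← one_smul k x]
      rw [← add_smul, neg_add_cancel, zero_smul] }

end FreeObj

/-- The action of the symmetric group on the free operad. -/
def freeAct (n : ℕ) (p : ℤ) :
    Representation k (Equiv.Perm (Fin (n + 1))) (FreeObj E n p) where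
  toFun σ :=
    { toFun := Quotient.map (Pre.act σ) fun _ _ h => Rel.act_congr σ h
      map_add' := fun x y => by
        obtain ⟨x, rfl⟩ := FreeObj.mk_surjective x
        obtain ⟨y, rfl⟩ := FreeObj.mk_surjective y
        exact FreeObj.sound (Rel.act_add σ x y)
      map_smul' := fun t x => by
        obtain ⟨x, rfl⟩ := FreeObj.mk_surjective x
        exact FreeObj.sound (Rel.act_smul σ t x) }
  map_one' := by
    ext x
    obtain ⟨x, rfl⟩ := FreeObj.mk_surjective x
    exact FreeObj.sound (Rel.act_one x)
  map_mul' σ τ := by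
    ext x
    obtain ⟨x, rfl⟩ := FreeObj.mk_surjective x
    exact FreeObj.sound (Rel.act_mul σ τ x)

/-- The composition of the free operad. -/
def freeCirc {a b c : ℕ} (h : a + b = c) (i : Fin (b + 1)) {p q r : ℤ} (hr : p + q = r) :
    FreeObj E a p →ₗ[k] FreeObj E b q →ₗ[k] FreeObj E c r :=
  LinearMap.mk₂ k
    (Quotient.map₂ (Pre.circ h i hr) fun _ _ h₁ _ _ h₂ => Rel.circ_congr h i hr h₁ h₂)
    (fun x x' y => by
      obtain ⟨x, rfl⟩ := FreeObj.mk_surjective x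
      obtain ⟨x', rfl⟩ := FreeObj.mk_surjective x'
      obtain ⟨y, rfl⟩ := FreeObj.mk_surjective y
      exact FreeObj.sound (Rel.add_circ h i hr x x' y))
    (fun t x y => by
      obtain ⟨x, rfl⟩ := FreeObj.mk_surjective x
      obtain ⟨y, rfl⟩ := FreeObj.mk_surjective y
      exact FreeObj.sound (Rel.smul_circ h i hr t x y))
    (fun x y y' => by
      obtain ⟨x, rfl⟩ := FreeObj.mk_surjective x
      obtain ⟨y, rfl⟩ := FreeObj.mk_surjective y
      obtain ⟨y', rfl⟩ := FreeObj.mk_surjective y'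
      exact FreeObj.sound (Rel.circ_add h i hr x y y'))
    (fun t x y => by
      obtain ⟨x, rfl⟩ := FreeObj.mk_surjective x
      obtain ⟨y, rfl⟩ := FreeObj.mk_surjective y
      exact FreeObj.sound (Rel.circ_smul h i hr t x y))

/-- The free operad `F(E)` on a collection `E`. -/
def free : Operad.{u, max u v} k where
  obj := FreeObj E
  act := freeAct E
  circ := freeCirc E
  assoc_nested := by
    intro a b c ab bc abc hab hbc h₁ h₂ p q r pq qr pqr hpq hqr h₃ h₄ i j f g h
    obtain ⟨f, rfl⟩ := FreeObj.mk_surjective f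
    obtain ⟨g, rfl⟩ := FreeObj.mk_surjective g
    obtain ⟨h, rfl⟩ := FreeObj.mk_surjective h
    exact FreeObj.sound (Rel.assoc_nested hab hbc h₁ h₂ hpq hqr h₃ h₄ i j f g h)
  assoc_parallel := by
    intro a b c ac bc abc hac hbc h₁ h₂ p q r pr qr pqr hpr hqr h₃ h₄ i j hij f g h
    obtain ⟨f, rfl⟩ := FreeObj.mk_surjective f
    obtain ⟨g, rfl⟩ := FreeObj.mk_surjective g
    obtain ⟨h, rfl⟩ := FreeObj.mk_surjective h
    exact FreeObj.sound (Rel.assoc_parallel hac hbc h₁ h₂ hpr hqr h₃ h₄ i j hij f g h)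
  circ_act := by
    intro a b c h i p q r hr σ τ f g
    obtain ⟨f, rfl⟩ := FreeObj.mk_surjective f
    obtain ⟨g, rfl⟩ := FreeObj.mk_surjective g
    exact FreeObj.sound (Rel.circ_act h i hr σ τ f g)

/-- The inclusion of the generators `E → F(E)`. -/
def gen (n : ℕ) (p : ℤ) : E.obj n p →ₗ[k] (free E).obj n p where
  toFun e := FreeObj.mk (Pre.of e)
  map_add' e e' := FreeObj.sound (Rel.of_add e e')
  map_smul' t e := FreeObj.sound (Rel.of_smul t e)

variable {E}

/-- Words in the free operad, with their weights: `W j` is the set of generators of weight `j`, the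
weight is additive under composition and invariant under permutations of the inputs. -/
inductive IsWord (W : ℕ → ∀ n p, Submodule k (E.obj n p)) :
    ℕ → ∀ {n : ℕ} {p : ℤ}, (free E).obj n p → Prop
  | gen {j n : ℕ} {p : ℤ} (e : E.obj n p) (he : e ∈ W j n p) : IsWord W j (gen E n p e)
  | act {j n : ℕ} {p : ℤ} (σ : Equiv.Perm (Fin (n + 1))) (x : (free E).obj n p) :
      IsWord W j x → IsWord W j ((free E).act n p σ x)
  | circ {j l a b c : ℕ} (h : a + b = c) (i : Fin (b + 1)) {p q r : ℤ} (hr : p + q = r)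
      (x : (free E).obj a p) (y : (free E).obj b q) :
      IsWord W j x → IsWord W l y → IsWord W (j + l) ((free E).circ h i hr x y)

/-- The span of the words of weight `j`. -/
def weightPart (W : ℕ → ∀ n p, Submodule k (E.obj n p)) (j n : ℕ) (p : ℤ) :
    Submodule k ((free E).obj n p) :=
  Submodule.span k {x | IsWord W j x}

variable (E) in
/-- The length grading `F^l(E)`: all generators have weight `1`. -/
def lengthPart (l n : ℕ) (p : ℤ) : Submodule k ((free E).obj n p) :=
  weightPart (fun j _ _ => if j = 1 then ⊤ else ⊥) l n p

/-- The TJ-grading `F(E)^j` for `E = E^0 ⊕ E^1 ⊕ ⋯`: the generators in `E^j` have weight `j`. -/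
def tjPart (Δ : E.Decomposition) (j n : ℕ) (p : ℤ) : Submodule k ((free E).obj n p) :=
  weightPart Δ.piece j n p

/-- The part `H^j(F(E), d)` of the homology: the classes of the cycles in `F(E)^j`. -/
def tjHomology (Δ : E.Decomposition) (d : (free E).Differential) (j n : ℕ) (p : ℤ) :
    Submodule k (d.homology.obj n p) :=
  ((tjPart Δ j n p).comap (d.cycles n p).subtype).map (d.cl n p)

end Free

/-- A TJ-model (bigraded model) `ρ : (F(Z), d) → (H, 0)` of an operad `H` with `H(1) = 0`. -/
structure TJModel {k : Type u} [Field k] (H : Operad.{u, v} k) where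
  /-- the generators -/
  Z : Collection.{u, w} k
  reduced : Z.Reduced
  /-- the decomposition `Z = Z^0 ⊕ Z^1 ⊕ ⋯` -/
  dec : Z.Decomposition
  /-- the differential of `F(Z)` -/
  d : (free Z).Differential
  /-- the map to `H` -/
  ρ : DGHom d H.zeroDifferential
  /-- `d` lowers the TJ-degree by one -/
  d_zero : ∀ n p q (h : q + 1 = p), ∀ z ∈ dec.piece 0 n p, d.d n p q h (gen Z n p z) = 0
  d_succ : ∀ j n p q (h : q + 1 = p), ∀ z ∈ dec.piece (j + 1) n p,
    d.d n p q h (gen Z n p z) ∈ tjPart dec j n q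
  /-- `d(Z) ⊆ F^{≥ 2}(Z)` -/
  minimal : ∀ n p q (h : q + 1 = p) (z : Z.obj n p),
    d.d n p q h (gen Z n p z) ∈ ⨆ l : ℕ, ⨆ _ : 2 ≤ l, lengthPart Z l n q
  /-- `ρ` vanishes on `Z^{≥ 1}` -/
  ρ_succ : ∀ j n p, ∀ z ∈ dec.piece (j + 1) n p, ρ.map n p (gen Z n p z) = 0
  /-- `H^0(ρ) : H^0(F(Z), d) → H(H, 0) = H` is an isomorphism -/
  bijective : ∀ n p, Function.Bijective
    ((ρ.homologyHom.map n p).domRestrict (tjHomology dec d 0 n p))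
  /-- `H^{≥ 1}(F(Z), d) = 0` -/
  acyclic : ∀ j n p, 1 ≤ j → tjHomology dec d j n p = ⊥

end OperadModels

/-!
The differential `D` and the map `α` are constructed together by induction on the weight `j` of the
generators. In weights zero and one, `D = d` on the generators. Let `z` be a generator of weight
`j ≥ 2`. The element `D (d z)` has weight at most `j - 3`. It is a `D`-cycle, and `α` maps it to a
boundary. The leading part of such a cycle is a `d`-cycle, and in weight zero `ρ` annihilates it.
Hence it is a `d`-boundary, and descending induction on the weight gives `y` of weight at most
`j - 2` with `D y = D (d z)`. The class of the cycle `α (d z - y)` equals `ρ w` for some `w` of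
weight zero, so `D z = d z - y - w` makes `α (D z)` a boundary, and `α z` is any element whose
boundary it is. The possible pairs `(D z, α z)` form an equivariant linear relation, so averaging
over the symmetric group, which requires characteristic zero, makes the choice linear and
equivariant.

The same descending induction shows that `α` is injective on homology, and surjectivity only
involves weight zero, on which `D` vanishes and `α` represents `ρ`.
-/

namespace OperadModels

open Representation

section Representations

variable {k G V W : Type*} [Field k] [Group G] [AddCommGroup V] [Module k V] [AddCommGroup W]
  [Module k W] {ρ : Representation k G V} {τ : Representation k G W}

theorem averageMap_apply [Fintype G] [Invertible (Fintype.card G : k)] (x : V) :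
    averageMap ρ x = ⅟(Fintype.card G : k) • ∑ g, ρ g x := by
  simp [averageMap, GroupAlgebra.average, LinearMap.sum_apply]

theorem exists_intertwining_section [Finite G] [NeZero (Nat.card G : k)]
    (f : IntertwiningMap ρ τ) (hf : Function.Surjective f) :
    ∃ g : IntertwiningMap τ ρ, ∀ y, f (g y) = y := by
  have := Fintype.ofFinite G
  have hcard : (Fintype.card G : k) ≠ 0 := by
    simpa only [Nat.card_eq_fintype_card] using NeZero.ne (Nat.card G : k)
  let _ := invertibleOfNonzero hcard
  obtain ⟨l, hl⟩ := f.toLinearMap.exists_rightInverse_of_surjective (LinearMap.range_eq_top.2 hf)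
  have hfl (y : W) : f (l y) = y := LinearMap.congr_fun hl y
  refine ⟨invariantsEquivIntertwiningMap _ _ ⟨averageMap (linHom τ ρ) l, averageMap_invariant _ l⟩,
    fun y => ?_⟩
  change f (averageMap (linHom τ ρ) l y) = y
  have hgl (g : G) : f (ρ g (l (τ g⁻¹ y))) = y := by
    rw [f.isIntertwining, hfl, ← Module.End.mul_apply, ← map_mul, mul_inv_cancel, map_one,
      Module.End.one_apply]
  simp only [averageMap_apply, LinearMap.smul_apply, LinearMap.sum_apply, linHom_apply,
    LinearMap.comp_apply, map_smul, map_sum, hgl, Finset.sum_const, Finset.card_univ,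
    ← Nat.cast_smul_eq_nsmul k, invOf_smul_smul]

theorem exists_intertwining_graph_le [Finite G] [NeZero (Nat.card G : k)]
    (R : Subrepresentation (ρ.prod τ)) (hR : ∀ x, ∃ y, (x, y) ∈ R) :
    ∃ f : IntertwiningMap ρ τ, ∀ x, (x, f x) ∈ R := by
  let incl : IntertwiningMap R.toRepresentation (ρ.prod τ) :=
    LinearMap.intertwiningMap_of_isIntertwiningMap _ _ R.toSubmodule.subtype fun _ _ => rfl
  obtain ⟨s, hs⟩ := exists_intertwining_section ((IntertwiningMap.fst k ρ τ).comp incl)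
    fun x => let ⟨y, hy⟩ := hR x; ⟨⟨(x, y), hy⟩, rfl⟩
  refine ⟨((IntertwiningMap.snd k ρ τ).comp incl).comp s, fun x => ?_⟩
  have hx : (s x : V × W).1 = x := hs x
  have : (s x : V × W) = (x, (s x : V × W).2) := Prod.ext hx rfl
  exact this ▸ (s x).2

end Representations

section Signs

variable (k : Type u) [Field k]

theorem sgn_add (m n : ℤ) : sgn k (m + n) = sgn k m * sgn k n := by
  simp [sgn, Int.negOnePow_add]

theorem sgn_neg (m : ℤ) : sgn k (-m) = sgn k m := by
  simp [sgn]

theorem sgn_sub_one (m : ℤ) : sgn k (m - 1) = -sgn k m := by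
  simp [sgn, Int.negOnePow_sub]

end Signs

section Free

variable {k : Type u} [Field k] {E : Collection.{u, v} k}

theorem gen_act (n : ℕ) (p : ℤ) (σ : Equiv.Perm (Fin (n + 1))) (e : E.obj n p) :
    gen E n p (E.act n p σ e) = (free E).act n p σ (gen E n p e) :=
  FreeObj.sound (Rel.of_act σ e)

variable {N : ∀ n p, Submodule k ((free E).obj n p)}

theorem free_induction (hgen : ∀ n p e, gen E n p e ∈ N n p)
    (hact : ∀ n p σ, ∀ x ∈ N n p, (free E).act n p σ x ∈ N n p)
    (hcirc : ∀ {a b c : ℕ} (h : a + b = c) (i : Fin (b + 1)) {p q r : ℤ} (hr : p + q = r),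
      ∀ x ∈ N a p, ∀ y ∈ N b q, (free E).circ h i hr x y ∈ N c r)
    {n : ℕ} {p : ℤ} (x : (free E).obj n p) : x ∈ N n p := by
  obtain ⟨x, rfl⟩ := FreeObj.mk_surjective x
  induction x with
  | of e => exact hgen _ _ e
  | zero => exact zero_mem _
  | add x y hx hy => exact add_mem hx hy
  | smul t x hx => exact (N _ _).smul_mem t hx
  | act σ x hx => exact hact _ _ σ _ hx
  | circ h i hr x y hx hy => exact hcirc h i hr _ hx _ hy

variable {S : Operad.{u, w} k} (f : ∀ n p, IntertwiningMap (E.act n p) (S.act n p))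

/-- The value of a formal expression in an operad `S`, given values of the generators. -/
def Pre.eval : ∀ {n : ℕ} {p : ℤ}, Pre E n p → S.obj n p
  | _, _, .of e => f _ _ e
  | _, _, .zero => 0
  | _, _, .add x y => x.eval + y.eval
  | _, _, .smul t x => t • x.eval
  | _, _, .act σ x => S.act _ _ σ x.eval
  | _, _, .circ h i hr x y => S.circ h i hr x.eval y.eval

theorem Pre.eval_eq_of_rel {n : ℕ} {p : ℤ} {x y : Pre E n p} (h : Rel E x y) :
    x.eval f = y.eval f := by
  induction h with
  | refl => rfl
  | symm _ ih => exact ih.symm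
  | trans _ _ ih₁ ih₂ => exact ih₁.trans ih₂
  | assoc_nested => exact S.assoc_nested ..
  | assoc_parallel _ _ _ _ _ _ _ _ _ _ hij => exact S.assoc_parallel _ _ _ _ _ _ _ _ _ _ hij _ _ _
  | circ_act => exact S.circ_act ..
  | add_assoc => exact add_assoc _ _ _
  | add_comm => exact add_comm _ _
  | add_smul => exact add_smul _ _ _
  | mul_smul => exact mul_smul _ _ _
  | _ => simp_all [Pre.eval, IntertwiningMap.isIntertwining]

/-- The homomorphism from the free operad which extends an equivariant map on the generators. -/
def freeLift : (free E).Hom S where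
  map n p :=
    { toFun := Quotient.lift (Pre.eval f) fun _ _ => Pre.eval_eq_of_rel f
      map_add' := fun x y => by
        obtain ⟨x, rfl⟩ := FreeObj.mk_surjective x
        obtain ⟨y, rfl⟩ := FreeObj.mk_surjective y
        rfl
      map_smul' := fun t x => by
        obtain ⟨x, rfl⟩ := FreeObj.mk_surjective x
        rfl }
  map_act n p σ x := by
    obtain ⟨x, rfl⟩ := FreeObj.mk_surjective x
    rfl
  map_circ h i p q r hr x y := by
    obtain ⟨x, rfl⟩ := FreeObj.mk_surjective x
    obtain ⟨y, rfl⟩ := FreeObj.mk_surjective y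
    rfl

theorem freeLift_gen (n : ℕ) (p : ℤ) (e : E.obj n p) :
    (freeLift f).map n p (gen E n p e) = f n p e := rfl

end Free

section Derivations

variable {k : Type u} [Field k]

/-- A derivation of degree `-1` of an operad; its square need not vanish. -/
structure Operad.Derivation (S : Operad.{u, v} k) where
  /-- the components, from degree `p` to degree `q = p - 1` -/
  d : ∀ n p q, q + 1 = p → (S.obj n p →ₗ[k] S.obj n q)
  d_act : ∀ n p q (h : q + 1 = p) (σ : Equiv.Perm (Fin (n + 1))) (x : S.obj n p),
    d n p q h (S.act n p σ x) = S.act n q σ (d n p q h x)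
  d_circ : ∀ {a b c : ℕ} (h : a + b = c) (i : Fin (b + 1)) {p q r p' q' r' : ℤ} (hr : p + q = r)
      (hp : p' + 1 = p) (hq : q' + 1 = q) (hr' : r' + 1 = r) (f : S.obj a p) (g : S.obj b q),
    d c r r' hr' (S.circ h i hr f g) =
      S.circ h i (by omega) (d a p p' hp f) g +
        sgn k p • S.circ h i (by omega) f (d b q q' hq g)

variable {S : Operad.{u, v} k}

/-- A differential, regarded as a derivation. -/
def Operad.Differential.toDerivation (d : S.Differential) : S.Derivation :=
  { d with }

/-- A derivation of square zero, regarded as a differential. -/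
def Operad.Derivation.toDifferential (D : S.Derivation)
    (hD : ∀ n p q r (hq : q + 1 = p) (hr : r + 1 = q) x, D.d n q r hr (D.d n p q hq x) = 0) :
    S.Differential :=
  { D with d_d := hD }

/-- The difference of two derivations. -/
def Operad.Derivation.sub (D D' : S.Derivation) : S.Derivation where
  d n p q h := D.d n p q h - D'.d n p q h
  d_act n p q h σ x := by
    simp only [LinearMap.sub_apply, D.d_act, D'.d_act, map_sub]
  d_circ h i p q r p' q' r' hr hp hq hr' f g := by
    simp only [LinearMap.sub_apply, D.d_circ h i hr hp hq hr', D'.d_circ h i hr hp hq hr', map_sub]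
    module

variable (S) in
/-- The components of the square-zero extension of `S` by its own desuspension. The second component
of an element of degree `p` is a family over all `q` with `q + 1 = p`, so that no transport between
degrees is needed. -/
abbrev Operad.SquareZeroObj (n : ℕ) (p : ℤ) : Type v :=
  S.obj n p × ∀ q : {q : ℤ // q + 1 = p}, S.obj n q

variable (S) in
/-- The composition `(x, x') ∘ᵢ (y, y') = (x ∘ᵢ y, x' ∘ᵢ y + (-1)^|x| x ∘ᵢ y')` of the square-zero
extension. -/
def Operad.squareZeroCirc {a b c : ℕ} (h : a + b = c) (i : Fin (b + 1)) {p q r : ℤ}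
    (hr : p + q = r) : S.SquareZeroObj a p →ₗ[k] S.SquareZeroObj b q →ₗ[k] S.SquareZeroObj c r :=
  LinearMap.mk₂ k
    (fun x y => (S.circ h i hr x.1 y.1, fun r' =>
      S.circ h i (p := p - 1) (by have := r'.2; omega) (x.2 ⟨p - 1, by omega⟩) y.1 +
        sgn k p • S.circ h i (q := q - 1) (by have := r'.2; omega) x.1 (y.2 ⟨q - 1, by omega⟩)))
    (fun x x' y => by
      ext <;> simp only [map_add, Prod.fst_add, Prod.snd_add, Pi.add_apply, LinearMap.add_apply]
      module)
    (fun t x y => by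
      ext <;>
        simp only [map_smul, Prod.smul_fst, Prod.smul_snd, Pi.smul_apply, LinearMap.smul_apply]
      module)
    (fun x y y' => by
      ext <;> simp only [map_add, Prod.fst_add, Prod.snd_add, Pi.add_apply]
      module)
    (fun t x y => by
      ext <;> simp only [map_smul, Prod.smul_fst, Prod.smul_snd, Pi.smul_apply]
      module)

variable (S) in
/-- The square-zero extension of `S` by its own desuspension. A derivation of `S` is the second
component of an operad homomorphism `S → S.squareZero` whose first component is the identity. -/
def Operad.squareZero : Operad.{u, v} k where
  obj := S.SquareZeroObj
  act n p :=
    { toFun := fun σ => (S.act n p σ).prodMap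
        (LinearMap.pi fun q => S.act n q σ ∘ₗ LinearMap.proj q)
      map_one' := by ext <;> simp
      map_mul' := fun σ τ => by ext <;> simp }
  circ := S.squareZeroCirc
  assoc_nested := by
    intro a b c ab bc abc hab hbc h₁ h₂ p q r pq qr pqr hpq hqr h₃ h₄ i j f g h
    refine Prod.ext (S.assoc_nested ..) (funext fun ⟨r', hr'⟩ => ?_)
    simp only [squareZeroCirc, LinearMap.mk₂_apply, map_add, map_smul, smul_add,
      LinearMap.add_apply, LinearMap.smul_apply]
    rw [S.assoc_nested hab hbc h₁ h₂ (p := p - 1) (pq := pq - 1) (by omega) _ _ (by omega),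
      S.assoc_nested hab hbc h₁ h₂ (q := q - 1) (pq := pq - 1) (by omega) (by omega) _ (by omega),
      S.assoc_nested hab hbc h₁ h₂ hpq, smul_smul, ← sgn_add, hpq, add_assoc]
  assoc_parallel := by
    intro a b c ac bc abc hac hbc h₁ h₂ p q r pr qr pqr hpr hqr h₃ h₄ i j hij f g h
    refine Prod.ext (S.assoc_parallel _ _ _ _ _ _ _ _ _ _ hij _ _ _)
      (funext fun ⟨r', hr'⟩ => ?_)
    have sgn_left : sgn k ((p - 1) * q) = sgn k (p * q) * sgn k q := by
      rw [sub_one_mul, sub_eq_add_neg, sgn_add, sgn_neg]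
    have sgn_right : sgn k p * sgn k (p * (q - 1)) = sgn k (p * q) := by
      rw [← sgn_add]; ring_nf
    simp only [squareZeroCirc, LinearMap.mk₂_apply, map_add, map_smul, smul_add, Prod.smul_snd,
      Pi.smul_apply]
    rw [S.assoc_parallel hac hbc h₁ h₂ (p := p - 1) (pr := pr - 1) (by omega) _ _
        (by omega) i j hij,
      S.assoc_parallel hac hbc h₁ h₂ (q := q - 1) (pr := pr) (by omega) (by omega) _
        (by omega) i j hij,
      S.assoc_parallel hac hbc h₁ h₂ (r := r - 1) (pr := pr - 1) (by omega) (by omega) _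
        (by omega) i j hij, sgn_left, smul_smul, sgn_right]
    module
  circ_act := by
    intro a b c h i p q r hr σ τ f g
    refine Prod.ext (S.circ_act ..) (funext fun ⟨r', hr'⟩ => ?_)
    simp [squareZeroCirc, S.circ_act]

end Derivations

section FreeDerivation

variable {k : Type u} [Field k] {E : Collection.{u, v} k}
  (θ : ∀ n p q, q + 1 = p → IntertwiningMap (E.act n p) ((free E).act n q))

/-- The homomorphism `x ↦ (x, D x)` which encodes the derivation `D` with the values `θ` on the
generators. -/
def freeDerivationHom : (free E).Hom (free E).squareZero :=
  freeLift (S := (free E).squareZero) fun n p =>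
    LinearMap.intertwiningMap_of_isIntertwiningMap _ _
      ((gen E n p).prod (LinearMap.pi fun q => (θ n p q q.2).toLinearMap))
      fun σ e => Prod.ext (gen_act n p σ e) (funext fun q => (θ n p q q.2).isIntertwining _ _ σ e)

theorem freeDerivationHom_fst {n : ℕ} {p : ℤ} (x : (free E).obj n p) :
    ((freeDerivationHom θ).map n p x).1 = x := by
  refine free_induction
    (N := fun n p => ((LinearMap.fst k _ _).comp ((freeDerivationHom θ).map n p)).eqLocus .id)
    (fun n p e => rfl) (fun n p σ x hx => ?_) (fun h i p q r hr x hx y hy => ?_) x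
  · exact (congrArg Prod.fst ((freeDerivationHom θ).map_act n p σ x)).trans
      (congrArg ((free E).act n p σ) hx)
  · exact (congrArg Prod.fst ((freeDerivationHom θ).map_circ h i hr x y)).trans
      (congrArg₂ (fun x y => (free E).circ h i hr x y) hx hy)

/-- The derivation of the free operad which extends an equivariant map on the generators. -/
def freeDerivation : (free E).Derivation where
  d n p q h := (LinearMap.proj (⟨q, h⟩ : {q : ℤ // q + 1 = p})).comp
    ((LinearMap.snd k _ _).comp ((freeDerivationHom θ).map n p))
  d_act n p q h σ x :=
    congrFun (congrArg Prod.snd ((freeDerivationHom θ).map_act n p σ x)) ⟨q, h⟩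
  d_circ {a b c} h i p q r p' q' r' hr hp hq hr' x y := by
    obtain rfl : p' = p - 1 := by omega
    obtain rfl : q' = q - 1 := by omega
    have := congrFun (congrArg Prod.snd ((freeDerivationHom θ).map_circ h i hr x y)) ⟨r', hr'⟩
    refine this.trans ?_
    change (free E).circ h i _ _ ((freeDerivationHom θ).map b q y).1 +
      sgn k p • (free E).circ h i _ ((freeDerivationHom θ).map a p x).1 _ = _
    rw [freeDerivationHom_fst, freeDerivationHom_fst]
    rfl

theorem freeDerivation_gen (n : ℕ) (p q : ℤ) (h : q + 1 = p) (e : E.obj n p) :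
    (freeDerivation θ).d n p q h (gen E n p e) = θ n p q h e := rfl

end FreeDerivation

section Gluing

variable {ι k G V W : Type*} [DecidableEq ι] [Field k] [Monoid G] [AddCommGroup V] [Module k V]
  [AddCommGroup W] [Module k W] {ρ : Representation k G V} {τ : Representation k G W}
  {N : ι → Subrepresentation ρ} (hN : DirectSum.IsInternal fun i => (N i).toSubmodule)
  (f : ∀ i, IntertwiningMap (N i).toRepresentation τ)

/-- The linear map which is given by `f i` on the summand `N i` of an internal direct sum. -/
noncomputable def glueLinearMap : V →ₗ[k] W :=
  (DirectSum.toModule k ι W fun i => (f i).toLinearMap) ∘ₗ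
    (LinearEquiv.ofBijective (DirectSum.coeLinearMap _) hN).symm.toLinearMap

theorem glueLinearMap_apply_of_mem {i : ι} {x : V} (hx : x ∈ (N i).toSubmodule) :
    glueLinearMap hN f x = f i ⟨x, hx⟩ := by
  have hsymm : (LinearEquiv.ofBijective (DirectSum.coeLinearMap _) hN).symm x =
      DirectSum.lof k ι (fun i => (N i).toSubmodule) i ⟨x, hx⟩ :=
    (LinearEquiv.symm_apply_eq _).2 (DirectSum.coeLinearMap_lof _ i ⟨x, hx⟩).symm
  rw [glueLinearMap, LinearMap.comp_apply, LinearEquiv.coe_coe, hsymm, DirectSum.toModule_lof]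
  rfl

/-- The equivariant map which is given by `f i` on the summand `N i` of an internal direct sum. -/
noncomputable def glue : IntertwiningMap ρ τ :=
  LinearMap.intertwiningMap_of_isIntertwiningMap _ _ (glueLinearMap hN f) fun g x => by
    have hx : x ∈ ⨆ i, (N i).toSubmodule := hN.submodule_iSup_eq_top ▸ Submodule.mem_top
    induction hx using Submodule.iSup_induction' with
    | mem i x hx =>
      rw [glueLinearMap_apply_of_mem hN f hx,
        glueLinearMap_apply_of_mem hN f ((N i).apply_mem_toSubmodule g hx)]
      exact (f i).isIntertwining _ _ g ⟨x, hx⟩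
    | zero => simp only [map_zero]
    | add x y _ _ hx hy => simp only [map_add, hx, hy]

theorem glue_apply_of_mem {i : ι} {x : V} (hx : x ∈ (N i).toSubmodule) :
    glue hN f x = f i ⟨x, hx⟩ :=
  glueLinearMap_apply_of_mem hN f hx

end Gluing

/-- The summand `E^j` in arity `n + 1` and degree `p`, as a subrepresentation. -/
def Collection.Decomposition.pieceRep {k : Type u} [Field k] {E : Collection.{u, v} k}
    (Δ : E.Decomposition) (n : ℕ) (p : ℤ) (j : ℕ) : Subrepresentation (E.act n p) where
  toSubmodule := Δ.piece j n p
  apply_mem_toSubmodule σ _ hx := Δ.act_mem j n p σ _ hx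

theorem exists_forall_of_update {X : ℕ → Type*} [∀ j, Nonempty (X j)] {P : ℕ → (∀ j, X j) → Prop}
    (hcongr : ∀ m f g, (∀ j ≤ m, f j = g j) → P m f → P m g)
    (hstep : ∀ m f, (∀ j < m, P j f) → ∃ x, P m (Function.update f m x)) :
    ∃ f, ∀ m, P m f := by
  choose next hnext using hstep
  let F (m : ℕ) : {f : ∀ j, X j // ∀ j < m, P j f} :=
    Nat.rec ⟨fun _ => Classical.arbitrary _, fun _ h => absurd h (Nat.not_lt_zero _)⟩
      (fun m f => ⟨Function.update f.1 m (next m f.1 f.2), fun j hj => by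
        rcases Nat.lt_succ_iff_lt_or_eq.1 hj with hj | rfl
        · exact hcongr j _ _ (fun i hi => (Function.update_of_ne (by omega) _ _).symm) (f.2 j hj)
        · exact hnext _ _ _⟩) m
  have F_succ (m j : ℕ) (h : j < m) : (F (m + 1)).1 j = (F m).1 j :=
    Function.update_of_ne h.ne _ _
  have F_stable (m j : ℕ) (h : j < m) : (F m).1 j = (F (j + 1)).1 j := by
    induction m, h using Nat.le_induction with
    | base => rfl
    | succ m hm ih => rw [F_succ m j hm, ih]
  exact ⟨fun j => (F (j + 1)).1 j, fun m => hcongr m (F (m + 1)).1 _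
    (fun j hj => F_stable _ j (Nat.lt_succ_of_le hj)) ((F (m + 1)).2 m m.lt_succ_self)⟩

section Weights

variable {k : Type u} [Field k] {E : Collection.{u, v} k}
  {W : ℕ → ∀ n p, Submodule k (E.obj n p)} {I J K L : Set ℕ} {n : ℕ} {p : ℤ}

theorem gen_mem_weightPart {j : ℕ} {e : E.obj n p} (he : e ∈ W j n p) :
    gen E n p e ∈ weightPart W j n p :=
  Submodule.subset_span (.gen e he)

theorem act_mem_weightPart {j : ℕ} (σ : Equiv.Perm (Fin (n + 1))) {x : (free E).obj n p}
    (hx : x ∈ weightPart W j n p) : (free E).act n p σ x ∈ weightPart W j n p :=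
  (Submodule.span_le (p := (weightPart W j n p).comap ((free E).act n p σ))).2
    (fun y hy => Submodule.subset_span (.act σ y hy)) hx

theorem circ_mem_weightPart {j l a b c : ℕ} (h : a + b = c) (i : Fin (b + 1)) {p q r : ℤ}
    (hr : p + q = r) {x : (free E).obj a p} (hx : x ∈ weightPart W j a p) {y : (free E).obj b q}
    (hy : y ∈ weightPart W l b q) : (free E).circ h i hr x y ∈ weightPart W (j + l) c r := by
  have hle : Submodule.map₂ ((free E).circ h i hr) (weightPart W j a p) (weightPart W l b q) ≤
      weightPart W (j + l) c r := by
    rw [weightPart, weightPart, Submodule.map₂_span_span]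
    exact Submodule.span_mono (Set.image2_subset_iff.2 fun x hx y hy => .circ h i hr x y hx hy)
  exact hle (Submodule.apply_mem_map₂ _ hx hy)

theorem weightPart_le {N : ℕ → ∀ n p, Submodule k ((free E).obj n p)} {j : ℕ}
    (hgen : ∀ l ≤ j, ∀ n p, ∀ z ∈ W l n p, gen E n p z ∈ N l n p)
    (hact : ∀ l n p σ, ∀ x ∈ N l n p, (free E).act n p σ x ∈ N l n p)
    (hcirc : ∀ l m {a b c : ℕ} (h : a + b = c) (i : Fin (b + 1)) {p q r : ℤ} (hr : p + q = r),
      ∀ x ∈ N l a p, ∀ y ∈ N m b q, (free E).circ h i hr x y ∈ N (l + m) c r) :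
    weightPart W j n p ≤ N j n p := by
  refine Submodule.span_le.2 fun x hx => ?_
  induction hx with
  | gen e he => exact hgen _ le_rfl _ _ _ he
  | act σ x _ ih => exact hact _ _ _ σ _ (ih hgen)
  | circ h i hr x y _ _ ihx ihy =>
    exact hcirc _ _ h i hr _ (ihx fun l hl => hgen l (by omega)) _
      (ihy fun l hl => hgen l (by omega))

variable (W) in
/-- The sum of the parts of the free operad whose weights lie in `I`. The filtration
`F(E)^{≤ m - s}` of the paper is `weightSum W {l | l + s ≤ m}`, which is zero for `m < s`. -/
def weightSum (I : Set ℕ) (n : ℕ) (p : ℤ) : Submodule k ((free E).obj n p) :=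
  ⨆ l ∈ I, weightPart W l n p

theorem weightPart_le_weightSum {j : ℕ} (hj : j ∈ I) : weightPart W j n p ≤ weightSum W I n p :=
  le_iSup₂_of_le (f := fun l (_ : l ∈ I) => weightPart W l n p) j hj le_rfl

theorem weightSum_le {N : Submodule k ((free E).obj n p)}
    (h : ∀ l ∈ I, weightPart W l n p ≤ N) : weightSum W I n p ≤ N :=
  iSup₂_le h

theorem weightSum_mono (h : I ⊆ J) : weightSum W I n p ≤ weightSum W J n p :=
  weightSum_le fun _ hl => weightPart_le_weightSum (h hl)

theorem weightSum_empty : weightSum W ∅ n p = ⊥ :=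
  iSup_emptyset

theorem eq_zero_of_mem_weightSum_Iio_zero {x : (free E).obj n p}
    (hx : x ∈ weightSum W (Set.Iio 0) n p) : x = 0 := by
  have h0 : Set.Iio (0 : ℕ) = ∅ := Set.eq_empty_of_forall_notMem Nat.not_lt_zero
  rwa [h0, weightSum_empty, Submodule.mem_bot] at hx

theorem weightSum_singleton (j : ℕ) : weightSum W {j} n p = weightPart W j n p :=
  iSup_singleton

theorem weightSum_union : weightSum W (I ∪ J) n p = weightSum W I n p ⊔ weightSum W J n p :=
  iSup_union

theorem act_mem_weightSum (σ : Equiv.Perm (Fin (n + 1))) {x : (free E).obj n p}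
    (hx : x ∈ weightSum W I n p) : (free E).act n p σ x ∈ weightSum W I n p :=
  weightSum_le (N := (weightSum W I n p).comap ((free E).act n p σ))
    (fun _ hl _ hy => weightPart_le_weightSum hl (act_mem_weightPart σ hy)) hx

theorem circ_mem_weightSum (hIJ : ∀ l ∈ I, ∀ m ∈ J, l + m ∈ K) {a b c : ℕ} (h : a + b = c)
    (i : Fin (b + 1)) {p q r : ℤ} (hr : p + q = r) {x : (free E).obj a p}
    (hx : x ∈ weightSum W I a p) {y : (free E).obj b q} (hy : y ∈ weightSum W J b q) :
    (free E).circ h i hr x y ∈ weightSum W K c r := by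
  have hle : Submodule.map₂ ((free E).circ h i hr) (weightSum W I a p) (weightSum W J b q) ≤
      weightSum W K c r := by
    simp only [weightSum, Submodule.map₂_iSup_left, Submodule.map₂_iSup_right, iSup_le_iff,
      Submodule.map₂_le]
    exact fun m hm l hl x hx y hy =>
      weightPart_le_weightSum (hIJ l hl m hm) (circ_mem_weightPart h i hr hx hy)
  exact hle (Submodule.apply_mem_map₂ _ hx hy)

theorem weightSum_univ (hW : ∀ n p, ⨆ j, W j n p = ⊤) :
    weightSum W Set.univ n p = ⊤ := by
  refine eq_top_iff.2 fun x _ => free_induction (N := weightSum W Set.univ) (fun n p e => ?_)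
    (fun n p σ x hx => act_mem_weightSum σ hx)
    (fun h i p q r hr x hx y hy =>
      circ_mem_weightSum (fun _ _ _ _ => Set.mem_univ _) h i hr hx hy) x
  have he : e ∈ ⨆ j, W j n p := hW n p ▸ Submodule.mem_top
  refine (iSup_le fun j z hz => ?_ :
    ⨆ j, W j n p ≤ (weightSum W Set.univ n p).comap (gen E n p)) he
  exact weightPart_le_weightSum (Set.mem_univ j) (gen_mem_weightPart hz)

theorem exists_mem_weightSum_Iio (hW : ∀ n p, ⨆ j, W j n p = ⊤) (x : (free E).obj n p) :
    ∃ m, x ∈ weightSum W (Set.Iio m) n p := by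
  have hx : x ∈ ⨆ j, weightPart W j n p :=
    (iSup_univ (f := fun j => weightPart W j n p)).le ((weightSum_univ hW).ge Submodule.mem_top)
  induction hx using Submodule.iSup_induction' with
  | mem j x hx => exact ⟨j + 1, weightPart_le_weightSum (Set.mem_Iio.2 j.lt_succ_self) hx⟩
  | zero => exact ⟨0, zero_mem _⟩
  | add x y _ _ hx hy =>
    obtain ⟨⟨l, hx⟩, ⟨m, hy⟩⟩ := hx, hy
    exact ⟨max l m, add_mem (weightSum_mono (Set.Iio_subset_Iio (le_max_left l m)) hx)
      (weightSum_mono (Set.Iio_subset_Iio (le_max_right l m)) hy)⟩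

theorem exists_sub_mem_weightSum_Iio {m : ℕ} {x : (free E).obj n p}
    (hx : x ∈ weightSum W (Set.Iio (m + 1)) n p) :
    ∃ y ∈ weightPart W m n p, x - y ∈ weightSum W (Set.Iio m) n p := by
  have hm : Set.Iio (m + 1) = {m} ∪ Set.Iio m := Order.Iio_succ_eq_insert m
  rw [hm, weightSum_union, weightSum_singleton] at hx
  obtain ⟨y, hy, z, hz, rfl⟩ := Submodule.mem_sup.1 hx
  exact ⟨y, hy, by rwa [add_sub_cancel_left]⟩

/-- A set of weights for each `j`, assigned compatibly with sums, such as `{l | l + s ≤ j}`. -/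
def IsShift (I : ℕ → Set ℕ) : Prop :=
  ∀ ⦃j l⦄, l ∈ I j → ∀ m, l + m ∈ I (j + m)

theorem isShift_setOf_add_le (s : ℕ) : IsShift fun j => {l | l + s ≤ j} :=
  fun j l (hl : l + s ≤ j) m => show l + m + s ≤ j + m by omega

theorem Operad.Derivation.mem_weightSum_of_mem_weightPart (D : (free E).Derivation)
    {I : ℕ → Set ℕ} (hI : IsShift I) {j : ℕ}
    (hD : ∀ l ≤ j, ∀ n p q (h : q + 1 = p), ∀ z ∈ W l n p,
      D.d n p q h (gen E n p z) ∈ weightSum W (I l) n q)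
    {q : ℤ} (h : q + 1 = p) {x : (free E).obj n p} (hx : x ∈ weightPart W j n p) :
    D.d n p q h x ∈ weightSum W (I j) n q := by
  obtain rfl : q = p - 1 := by omega
  refine (weightPart_le (j := j) (N := fun j n p => weightPart W j n p ⊓
    (weightSum W (I j) n (p - 1)).comap (D.d n p (p - 1) (sub_add_cancel p 1)))
    (fun l hl n p z hz => ⟨gen_mem_weightPart hz, hD l hl _ _ _ _ z hz⟩)
    (fun l n p σ x hx => ⟨act_mem_weightPart σ hx.1, ?_⟩)
    (fun l m a b c h i p q r hr x hx y hy => ⟨circ_mem_weightPart h i hr hx.1 hy.1, ?_⟩) hx).2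
  · rw [SetLike.mem_coe, Submodule.mem_comap, D.d_act]
    exact act_mem_weightSum σ hx.2
  · rw [SetLike.mem_coe, Submodule.mem_comap,
      D.d_circ h i hr (sub_add_cancel p 1) (sub_add_cancel q 1) (sub_add_cancel r 1)]
    have hxl := weightPart_le_weightSum (Set.mem_singleton l) hx.1
    have hym := weightPart_le_weightSum (Set.mem_singleton m) hy.1
    refine add_mem (circ_mem_weightSum ?_ h i _ hx.2 hym)
      (Submodule.smul_mem _ _ (circ_mem_weightSum ?_ h i _ hxl hy.2))
    · rintro s hs _ rfl
      exact hI hs _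
    · rintro _ rfl s hs
      rw [add_comm _ s, add_comm _ m]
      exact hI hs _

theorem Operad.Derivation.mem_weightSum (D : (free E).Derivation) {I : ℕ → Set ℕ}
    (hI : IsShift I) (hJ : IsLowerSet J)
    (hD : ∀ j ∈ J, ∀ n p q (h : q + 1 = p), ∀ z ∈ W j n p,
      D.d n p q h (gen E n p z) ∈ weightSum W (I j) n q)
    (hLJ : L ⊆ J) (hLK : ∀ j ∈ L, I j ⊆ K) {q : ℤ} (h : q + 1 = p) {x : (free E).obj n p}
    (hx : x ∈ weightSum W L n p) : D.d n p q h x ∈ weightSum W K n q :=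
  weightSum_le (N := (weightSum W K n q).comap (D.d n p q h)) (fun j hj _ hx =>
    weightSum_mono (hLK j hj) (D.mem_weightSum_of_mem_weightPart hI
      (fun l hl => hD l (hJ hl (hLJ hj))) h hx)) hx

theorem Operad.Derivation.eqOn_weightSum (D D' : (free E).Derivation) (hJ : IsLowerSet J)
    (hD : ∀ j ∈ J, ∀ n p q (h : q + 1 = p), ∀ z ∈ W j n p,
      D.d n p q h (gen E n p z) = D'.d n p q h (gen E n p z))
    {q : ℤ} (h : q + 1 = p) {x : (free E).obj n p} (hx : x ∈ weightSum W J n p) :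
    D.d n p q h x = D'.d n p q h x := by
  have := (D.sub D').mem_weightSum (I := fun _ => ∅) (K := ∅) (fun _ _ h => h.elim) hJ
    (fun j hj n p q h z hz => by
      rw [Operad.Derivation.sub, LinearMap.sub_apply, hD j hj n p q h z hz, sub_self]
      exact zero_mem _) subset_rfl (fun _ _ => subset_rfl) h hx
  rwa [weightSum_empty, Submodule.mem_bot, Operad.Derivation.sub, LinearMap.sub_apply,
    sub_eq_zero] at this

theorem weightSum_le_of_closed {N : ∀ n p, Submodule k ((free E).obj n p)} (hJ : IsLowerSet J)
    (hgen : ∀ j ∈ J, ∀ n p, ∀ z ∈ W j n p, gen E n p z ∈ N n p)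
    (hact : ∀ n p σ, ∀ x ∈ N n p, (free E).act n p σ x ∈ N n p)
    (hcirc : ∀ {a b c : ℕ} (h : a + b = c) (i : Fin (b + 1)) {p q r : ℤ} (hr : p + q = r),
      ∀ x ∈ N a p, ∀ y ∈ N b q, (free E).circ h i hr x y ∈ N c r) :
    weightSum W J n p ≤ N n p :=
  weightSum_le fun _ hj => weightPart_le (N := fun _ => N) (fun l hl => hgen l (hJ hl hj))
    (fun _ => hact) (fun _ _ => hcirc)

theorem Operad.Derivation.d_d_eq_zero_of_mem_weightSum (D : (free E).Derivation)
    (hJ : IsLowerSet J)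
    (hD : ∀ j ∈ J, ∀ n p q r (h : q + 1 = p) (hr : r + 1 = q), ∀ z ∈ W j n p,
      D.d n q r hr (D.d n p q h (gen E n p z)) = 0)
    {q r : ℤ} (h : q + 1 = p) (hr : r + 1 = q) {x : (free E).obj n p}
    (hx : x ∈ weightSum W J n p) : D.d n q r hr (D.d n p q h x) = 0 := by
  obtain ⟨rfl, rfl⟩ : q = p - 1 ∧ r = p - 1 - 1 := by omega
  refine weightSum_le_of_closed (N := fun n p => LinearMap.ker
    (D.d n (p - 1) (p - 1 - 1) (by omega) ∘ₗ D.d n p (p - 1) (by omega))) hJ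
    (fun j hj n p z hz => hD j hj _ _ _ _ _ _ z hz) (fun n p σ x hx => ?_)
    (fun h i p q r hr x hx y hy => ?_) hx
  · rw [LinearMap.mem_ker, LinearMap.comp_apply] at hx ⊢
    rw [D.d_act, D.d_act, hx, map_zero]
  · rw [LinearMap.mem_ker, LinearMap.comp_apply] at hx hy ⊢
    have hp := sub_add_cancel p 1
    have hq := sub_add_cancel q 1
    rw [D.d_circ h i hr hp hq (sub_add_cancel r 1), map_add, map_smul,
      D.d_circ h i _ (sub_add_cancel _ 1) hq, D.d_circ h i _ hp (sub_add_cancel _ 1), hx, hy,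
      sgn_sub_one, map_zero, map_zero, LinearMap.zero_apply]
    module

theorem Operad.Hom.map_d_of_mem_weightSum {S : Operad.{u, w} k} (φ : (free E).Hom S)
    (D : (free E).Derivation) (D' : S.Derivation) (hJ : IsLowerSet J)
    (hφ : ∀ j ∈ J, ∀ n p q (h : q + 1 = p), ∀ z ∈ W j n p,
      φ.map n q (D.d n p q h (gen E n p z)) = D'.d n p q h (φ.map n p (gen E n p z)))
    {q : ℤ} (h : q + 1 = p) {x : (free E).obj n p} (hx : x ∈ weightSum W J n p) :
    φ.map n q (D.d n p q h x) = D'.d n p q h (φ.map n p x) := by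
  obtain rfl : q = p - 1 := by omega
  refine weightSum_le_of_closed (N := fun n p => LinearMap.eqLocus
    (φ.map n (p - 1) ∘ₗ D.d n p (p - 1) (by omega)) (D'.d n p (p - 1) (by omega) ∘ₗ φ.map n p)) hJ
    (fun j hj n p z hz => hφ j hj _ _ _ _ z hz) (fun n p σ x hx => ?_)
    (fun h i p q r hr x hx y hy => ?_) hx
  · rw [LinearMap.mem_eqLocus, LinearMap.comp_apply, LinearMap.comp_apply] at hx ⊢
    rw [D.d_act, φ.map_act, φ.map_act, D'.d_act, hx]
  · rw [LinearMap.mem_eqLocus, LinearMap.comp_apply, LinearMap.comp_apply] at hx hy ⊢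
    have hp := sub_add_cancel p 1
    have hq := sub_add_cancel q 1
    have hr' := sub_add_cancel r 1
    rw [D.d_circ h i hr hp hq hr', φ.map_circ, D'.d_circ h i hr hp hq hr', map_add, map_smul,
      φ.map_circ, φ.map_circ, hx, hy]

theorem Operad.Hom.eqOn_weightSum {S : Operad.{u, w} k} (φ ψ : (free E).Hom S)
    (hJ : IsLowerSet J)
    (h : ∀ j ∈ J, ∀ n p, ∀ z ∈ W j n p, φ.map n p (gen E n p z) = ψ.map n p (gen E n p z))
    {x : (free E).obj n p} (hx : x ∈ weightSum W J n p) : φ.map n p x = ψ.map n p x := by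
  refine weightSum_le_of_closed (N := fun n p => (φ.map n p).eqLocus (ψ.map n p)) hJ h
    (fun n p σ x hx => ?_) (fun h i p q r hr x hx y hy => ?_) hx
  · rw [LinearMap.mem_eqLocus] at hx ⊢
    rw [φ.map_act, ψ.map_act, hx]
  · rw [LinearMap.mem_eqLocus] at hx hy ⊢
    rw [φ.map_circ, ψ.map_circ, hx, hy]

end Weights

section Independence

variable {k : Type u} [Field k] [CharZero k] {E : Collection.{u, v} k} (Δ : E.Decomposition)

theorem iSupIndep_weightPart (n : ℕ) (p : ℤ) :
    iSupIndep fun j => weightPart Δ.piece j n p := by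
  let f (n : ℕ) (p : ℤ) : IntertwiningMap (E.act n p) ((free E).act n p) :=
    glue (N := Δ.pieceRep n p) (Δ.isInternal n p) fun j =>
      LinearMap.intertwiningMap_of_isIntertwiningMap _ _
        ((2 : k) ^ j • gen E n p ∘ₗ (Δ.piece j n p).subtype) fun σ x => by
          exact (congrArg ((2 : k) ^ j • ·) (gen_act n p σ x.1)).trans (map_smul ..).symm
  -- The weight parts are eigenspaces of the endomorphism which multiplies `E^j` by `2 ^ j`.
  let ψ := freeLift f
  have hψ (j : ℕ) : weightPart Δ.piece j n p ≤ Module.End.eigenspace (ψ.map n p) (2 ^ j) := by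
    refine weightPart_le (N := fun j n p =>
      Module.End.eigenspace (ψ.map n p : Module.End k ((free E).obj n p)) (2 ^ j))
      (fun j _ n p z hz => ?_) (fun j n p σ x hx => ?_)
      (fun j l a b c h i p q r hr x hx y hy => ?_)
    · rw [Module.End.mem_eigenspace_iff, freeLift_gen]
      exact glue_apply_of_mem (N := Δ.pieceRep n p) _ _ hz
    · rw [Module.End.mem_eigenspace_iff] at hx ⊢
      rw [ψ.map_act, hx, map_smul]
    · rw [Module.End.mem_eigenspace_iff] at hx hy ⊢
      rw [ψ.map_circ, hx, hy, map_smul, map_smul, LinearMap.smul_apply, smul_smul, pow_add,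
        mul_comm]
  have hinj : Function.Injective fun j : ℕ => (2 : k) ^ j := fun i j hij =>
    Nat.pow_right_injective le_rfl (by dsimp only at hij; exact_mod_cast hij)
  exact ((Module.End.eigenspaces_iSupIndep (ψ.map n p)).comp hinj).mono hψ

theorem disjoint_weightSum {I J : Set ℕ} (h : Disjoint I J) (n : ℕ) (p : ℤ) :
    Disjoint (weightSum Δ.piece I n p) (weightSum Δ.piece J n p) :=
  (iSupIndep_weightPart Δ n p).disjoint_biSup_biSup h

end Independence

section HomologyClasses

variable {k : Type u} [Field k] {S : Operad.{u, v} k} (d : S.Differential)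

/-- The pairs consisting of a cycle and its homology class, as a linear relation. -/
def Operad.Differential.clGraph (n : ℕ) (p : ℤ) :
    Submodule k (S.obj n p × d.homology.obj n p) :=
  LinearMap.range ((d.cycles n p).subtype.prod (d.cl n p))

variable {d} {n : ℕ} {p q : ℤ}

theorem Operad.Differential.cl_eq_zero_iff (h : q + 1 = p) {x : d.cycles n q} :
    d.cl n q x = 0 ↔ ∃ y, d.d n p q h y = x.1 := by
  subst h
  exact Submodule.Quotient.mk_eq_zero _

theorem Operad.Differential.exists_mem_clGraph (c : d.homology.obj n p) :
    ∃ s, (s, c) ∈ d.clGraph n p := by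
  obtain ⟨s, rfl⟩ := Submodule.mkQ_surjective _ c
  exact ⟨s, s, rfl⟩

theorem Operad.Differential.mem_clGraph {s : S.obj n p} {c : d.homology.obj n p} :
    (s, c) ∈ d.clGraph n p ↔ ∃ h : s ∈ d.cycles n p, d.cl n p ⟨s, h⟩ = c := by
  constructor
  · rintro ⟨x, hx⟩
    obtain ⟨rfl, rfl⟩ := Prod.mk.inj hx
    exact ⟨x.2, rfl⟩
  · rintro ⟨h, rfl⟩
    exact ⟨⟨s, h⟩, rfl⟩

theorem Operad.Differential.d_eq_zero_of_mem_clGraph {s : S.obj n p} {c : d.homology.obj n p}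
    (hs : (s, c) ∈ d.clGraph n p) (h : q + 1 = p) : d.d n p q h s = 0 :=
  d.mem_cycles.1 (d.mem_clGraph.1 hs).1 q h

theorem Operad.Differential.mem_clGraph_zero (h : q + 1 = p) {s : S.obj n q} :
    (s, 0) ∈ d.clGraph n q ↔ ∃ y, d.d n p q h y = s := by
  rw [mem_clGraph]
  constructor
  · rintro ⟨hs, hcl⟩
    exact (cl_eq_zero_iff h).1 hcl
  · rintro ⟨y, rfl⟩
    exact ⟨d.mem_cycles.2 fun _ _ => d.d_d .., (cl_eq_zero_iff h).2 ⟨y, rfl⟩⟩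

theorem Operad.Differential.act_mem_clGraph (σ : Equiv.Perm (Fin (n + 1))) {s : S.obj n p}
    {c : d.homology.obj n p} (h : (s, c) ∈ d.clGraph n p) :
    (S.act n p σ s, d.homology.act n p σ c) ∈ d.clGraph n p := by
  obtain ⟨hs, rfl⟩ := mem_clGraph.1 h
  exact mem_clGraph.2 ⟨d.act_mem_cycles σ _ hs, rfl⟩

theorem Operad.Differential.circ_mem_clGraph {a b c : ℕ} (h : a + b = c) (i : Fin (b + 1))
    {p q r : ℤ} (hr : p + q = r) {s : S.obj a p} {x : d.homology.obj a p}
    (hs : (s, x) ∈ d.clGraph a p) {t : S.obj b q} {y : d.homology.obj b q}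
    (ht : (t, y) ∈ d.clGraph b q) :
    (S.circ h i hr s t, d.homology.circ h i hr x y) ∈ d.clGraph c r := by
  obtain ⟨hs', rfl⟩ := mem_clGraph.1 hs
  obtain ⟨ht', rfl⟩ := mem_clGraph.1 ht
  exact mem_clGraph.2 ⟨d.circ_mem_cycles h i hr hs' ht', rfl⟩

theorem Operad.Differential.eq_zero_of_mem_clGraph {c : d.homology.obj n p}
    (h : (0, c) ∈ d.clGraph n p) : c = 0 := by
  obtain ⟨_, rfl⟩ := mem_clGraph.1 h
  exact map_zero (d.cl n p)

theorem Operad.Differential.homologyHom_injective {T : Operad.{u, w} k} {dT : T.Differential}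
    (φ : DGHom d dT) (hpq : q + 1 = p)
    (hφ : ∀ x, (∀ r (h : r + 1 = q), d.d n q r h x = 0) → (φ.map n q x, 0) ∈ dT.clGraph n q →
      ∃ y, d.d n p q hpq y = x) :
    Function.Injective (φ.homologyHom.map n q) := by
  rw [injective_iff_map_eq_zero]
  intro c hc
  obtain ⟨x, rfl⟩ := Submodule.mkQ_surjective _ c
  exact (d.cl_eq_zero_iff hpq).2 (hφ x (d.mem_cycles.1 x.2)
    (mem_clGraph.2 ⟨φ.map_mem_cycles _ _ _ x.2, hc⟩))

theorem Operad.Differential.homologyHom_surjective {T : Operad.{u, w} k} {dT : T.Differential}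
    (φ : DGHom d dT)
    (hφ : ∀ c, ∃ x, (∀ q (h : q + 1 = p), d.d n p q h x = 0) ∧
      (φ.map n p x, c) ∈ dT.clGraph n p) :
    Function.Surjective (φ.homologyHom.map n p) := by
  intro c
  obtain ⟨x, hx, hxc⟩ := hφ c
  exact ⟨d.cl n p ⟨x, d.mem_cycles.2 hx⟩, (mem_clGraph.1 hxc).2⟩

theorem zeroDifferential_cl_injective (H : Operad.{u, v} k) (n : ℕ) (p : ℤ) :
    Function.Injective (H.zeroDifferential.cl n p) := by
  rw [injective_iff_map_eq_zero]
  intro x hx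
  obtain ⟨y, hy⟩ := (Operad.Differential.cl_eq_zero_iff rfl).1 hx
  exact Subtype.ext hy.symm

end HomologyClasses

section BigradedResolutions

variable {k : Type u} [Field k] {H : Operad.{u, v} k} {Z : Collection.{u, w} k}

/-- A bigraded resolution of an operad `H`: a bigraded model which need not be minimal, and whose
map to `H` may be nonzero on generators of positive weight. -/
structure IsBigradedResolution (Δ : Z.Decomposition) (d : (free Z).Differential)
    (ρ : DGHom d H.zeroDifferential) : Prop where
  d_zero : ∀ n p q (h : q + 1 = p), ∀ z ∈ Δ.piece 0 n p, d.d n p q h (gen Z n p z) = 0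
  d_succ : ∀ j n p q (h : q + 1 = p), ∀ z ∈ Δ.piece (j + 1) n p,
    d.d n p q h (gen Z n p z) ∈ tjPart Δ j n q
  bijective : ∀ n p, Function.Bijective
    ((ρ.homologyHom.map n p).domRestrict (tjHomology Δ d 0 n p))
  acyclic : ∀ j n p, 1 ≤ j → tjHomology Δ d j n p = ⊥

theorem TJModel.isBigradedResolution (M : TJModel.{u, v, w} H) :
    IsBigradedResolution M.dec M.d M.ρ where
  d_zero := M.d_zero
  d_succ := M.d_succ
  bijective := M.bijective
  acyclic := M.acyclic

theorem weightSum_univ_eq_top (Δ : Z.Decomposition) (n : ℕ) (p : ℤ) :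
    weightSum Δ.piece Set.univ n p = ⊤ :=
  weightSum_univ fun n p => (Δ.isInternal n p).submodule_iSup_eq_top

namespace IsBigradedResolution

variable {Δ : Z.Decomposition} {d : (free Z).Differential} {ρ : DGHom d H.zeroDifferential}
  (hd : IsBigradedResolution Δ d ρ) {n : ℕ} {p q : ℤ} (h : q + 1 = p)
include hd

theorem d_gen_mem {j : ℕ} {z : Z.obj n p} (hz : z ∈ Δ.piece j n p) :
    d.d n p q h (gen Z n p z) ∈ weightSum Δ.piece {l | l + 1 = j} n q := by
  cases j with
  | zero => exact hd.d_zero n p q h z hz ▸ zero_mem _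
  | succ j =>
    have hle : tjPart Δ j n q ≤ weightSum Δ.piece {l | l + 1 = j + 1} n q :=
      weightPart_le_weightSum (Set.mem_ofPred.2 rfl)
    exact hle (hd.d_succ j n p q h z hz)

theorem d_mem {J K : Set ℕ} (hJK : ∀ j ∈ J, ∀ l, l + 1 = j → l ∈ K) {x : (free Z).obj n p}
    (hx : x ∈ weightSum Δ.piece J n p) : d.d n p q h x ∈ weightSum Δ.piece K n q :=
  d.toDerivation.mem_weightSum (I := fun j => {l | l + 1 = j})
    (fun j l (hl : l + 1 = j) m => show l + m + 1 = j + m by omega)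
    isLowerSet_univ (fun _ _ _ _ _ h _ hz => hd.d_gen_mem h hz) (Set.subset_univ J) hJK h hx

theorem exists_weightPart_zero (c : H.obj n p) :
    ∃ x ∈ weightPart Δ.piece 0 n p, ρ.map n p x = c := by
  obtain ⟨⟨_, x, hx, rfl⟩, hxc⟩ := (hd.bijective n p).2
    (H.zeroDifferential.cl n p ⟨c, H.zeroDifferential.mem_cycles.2 fun _ _ => rfl⟩)
  exact ⟨x, hx, congrArg Subtype.val (zeroDifferential_cl_injective H n p hxc)⟩

theorem exists_weightPart_of_exists [CharZero k] {j : ℕ} {u : (free Z).obj n q}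
    (hu : u ∈ weightPart Δ.piece j n q) (hy : ∃ y, d.d n p q h y = u) :
    ∃ v ∈ weightPart Δ.piece (j + 1) n p, d.d n p q h v = u := by
  obtain ⟨y, rfl⟩ := hy
  have hy : y ∈ weightSum Δ.piece ({j + 1} ∪ {j + 1}ᶜ) n p := by
    rw [Set.union_compl_self, weightSum_univ_eq_top]
    exact Submodule.mem_top
  rw [weightSum_union, weightSum_singleton] at hy
  obtain ⟨v, hv, y', hy', rfl⟩ := Submodule.mem_sup.1 hy
  refine ⟨v, hv, ?_⟩
  have hdv : d.d n p q h v ∈ weightSum Δ.piece {j} n q :=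
    hd.d_mem h (by rintro _ rfl l hl; exact Nat.succ_injective hl)
      (weightPart_le_weightSum (Set.mem_singleton _) hv)
  have hdy' : d.d n p q h y' ∈ weightSum Δ.piece {j}ᶜ n q :=
    hd.d_mem h (by rintro i hi l rfl rfl; exact hi rfl) hy'
  have hdy'_zero : d.d n p q h y' = 0 := by
    refine Submodule.disjoint_def.1 (disjoint_weightSum Δ disjoint_compl_right n q) _ ?_ hdy'
    rw [← weightSum_singleton, map_add] at hu
    exact (Submodule.add_mem_iff_right _ hdv).1 hu
  rw [map_add, hdy'_zero, add_zero]

theorem exists_d_eq_of_mem_weightPart [CharZero k] {j : ℕ} {u : (free Z).obj n q}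
    (hu : u ∈ weightPart Δ.piece j n q) (hdu : ∀ r (hr : r + 1 = q), d.d n q r hr u = 0)
    (hρu : j = 0 → ρ.map n q u = 0) : ∃ v ∈ weightPart Δ.piece (j + 1) n p, d.d n p q h v = u := by
  let u' : d.cycles n q := ⟨u, d.mem_cycles.2 hdu⟩
  have hcl : d.cl n q u' ∈ tjHomology Δ d j n q := ⟨u', hu, rfl⟩
  refine hd.exists_weightPart_of_exists h hu ((d.cl_eq_zero_iff h (x := u')).1 ?_)
  rcases Nat.eq_zero_or_pos j with rfl | hj
  · refine congrArg Subtype.val ((hd.bijective n q).1 (a₁ := ⟨_, hcl⟩) (a₂ := 0) ?_)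
    have : ρ.cyclesMap n q u' = 0 := Subtype.ext (hρu rfl)
    exact (congrArg (H.zeroDifferential.cl n q) this).trans (by rw [map_zero, map_zero])
  · rwa [hd.acyclic j n q hj, Submodule.mem_bot] at hcl

end IsBigradedResolution
end BigradedResolutions

section FilteredModels

variable {k : Type u} [Field k] {S : Operad.{u, v} k} {dS : S.Differential}
  {Z : Collection.{u, w} k} (Δ : Z.Decomposition) {d : (free Z).Differential}
  (ρ : DGHom d dS.homology.zeroDifferential)
  (D : (free Z).Derivation) (α : (free Z).Hom S)

/-- The conditions on the values `y = D z` and `s = α z` at a generator `z` of weight `j` under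
which `D` and `α` extend from smaller weights as a perturbation of `d` and a chain map. In weight
zero, `s` has to represent the class `ρ z`. -/
structure IsAdmissibleValue (j : ℕ) {n : ℕ} {p q : ℤ} (h : q + 1 = p) (z : Z.obj n p)
    (y : (free Z).obj n q) (s : S.obj n p) : Prop where
  sub_mem : y - d.d n p q h (gen Z n p z) ∈ weightSum Δ.piece {l | l + 2 ≤ j} n q
  d_eq_zero : ∀ r (hr : r + 1 = q), D.d n q r hr y = 0
  map_eq : α.map n q y = dS.d n p q h s
  mem_clGraph : j = 0 → (s, ρ.map n p (gen Z n p z)) ∈ dS.clGraph n p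

namespace IsAdmissibleValue

variable {Δ ρ D α} {j n : ℕ} {p q : ℤ} {h : q + 1 = p} {z z' : Z.obj n p}
  {y y' : (free Z).obj n q} {s s' : S.obj n p}

theorem zero : IsAdmissibleValue Δ ρ D α j h (0 : Z.obj n p) 0 0 where
  sub_mem := by rw [map_zero, map_zero, sub_zero]; exact zero_mem _
  d_eq_zero _ _ := map_zero _
  map_eq := by rw [map_zero, map_zero]
  mem_clGraph _ := by rw [map_zero, map_zero]; exact zero_mem _

theorem add (hz : IsAdmissibleValue Δ ρ D α j h z y s)
    (hz' : IsAdmissibleValue Δ ρ D α j h z' y' s') :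
    IsAdmissibleValue Δ ρ D α j h (z + z') (y + y') (s + s') where
  sub_mem := by
    rw [map_add, map_add, add_sub_add_comm]
    exact add_mem hz.sub_mem hz'.sub_mem
  d_eq_zero r hr := by rw [map_add, hz.d_eq_zero, hz'.d_eq_zero, add_zero]
  map_eq := by rw [map_add, map_add, hz.map_eq, hz'.map_eq]
  mem_clGraph hj := by
    rw [map_add, map_add, ← Prod.mk_add_mk]
    exact add_mem (hz.mem_clGraph hj) (hz'.mem_clGraph hj)

theorem smul (t : k) (hz : IsAdmissibleValue Δ ρ D α j h z y s) :
    IsAdmissibleValue Δ ρ D α j h (t • z) (t • y) (t • s) where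
  sub_mem := by
    rw [map_smul, map_smul, ← smul_sub]
    exact Submodule.smul_mem _ t hz.sub_mem
  d_eq_zero r hr := by rw [map_smul, hz.d_eq_zero, smul_zero]
  map_eq := by rw [map_smul, map_smul, hz.map_eq]
  mem_clGraph hj := by
    rw [map_smul, map_smul, ← Prod.smul_mk]
    exact Submodule.smul_mem _ t (hz.mem_clGraph hj)

theorem act (σ : Equiv.Perm (Fin (n + 1))) (hz : IsAdmissibleValue Δ ρ D α j h z y s) :
    IsAdmissibleValue Δ ρ D α j h (Z.act n p σ z) ((free Z).act n q σ y) (S.act n p σ s) where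
  sub_mem := by
    rw [gen_act, d.d_act, ← map_sub]
    exact act_mem_weightSum σ hz.sub_mem
  d_eq_zero r hr := by rw [D.d_act, hz.d_eq_zero, map_zero]
  map_eq := by rw [α.map_act, dS.d_act, hz.map_eq]
  mem_clGraph hj := by
    rw [gen_act, ρ.map_act]
    exact Operad.Differential.act_mem_clGraph σ (hz.mem_clGraph hj)

end IsAdmissibleValue

/-- The admissible values at the generators of weight `j`, as an equivariant linear relation. -/
def admissibleValues (j : ℕ) {n : ℕ} {p q : ℤ} (h : q + 1 = p) :
    Subrepresentation ((Δ.pieceRep n p j).toRepresentation.prod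
      (((free Z).act n q).prod (S.act n p))) where
  toSubmodule :=
    { carrier := {x | IsAdmissibleValue Δ ρ D α j h x.1.1 x.2.1 x.2.2}
      zero_mem' := .zero
      add_mem' := .add
      smul_mem' := fun t _ => .smul t }
  apply_mem_toSubmodule σ _ := .act σ

/-- The derivation `D` and the homomorphism `α` have admissible values at the generators whose
weights lie in `J`. -/
def IsFilteredModelOn (J : Set ℕ) : Prop :=
  ∀ j ∈ J, ∀ n p q (h : q + 1 = p), ∀ z ∈ Δ.piece j n p,
    IsAdmissibleValue Δ ρ D α j h z (D.d n p q h (gen Z n p z)) (α.map n p (gen Z n p z))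

variable {Δ ρ D α} {J K : Set ℕ} {n : ℕ} {p q r : ℤ}

namespace IsFilteredModelOn

theorem mono (hD : IsFilteredModelOn Δ ρ D α J) (h : K ⊆ J) : IsFilteredModelOn Δ ρ D α K :=
  fun j hj => hD j (h hj)

theorem d_sub_d_mem (hD : IsFilteredModelOn Δ ρ D α J) (hJ : IsLowerSet J) {I L : Set ℕ}
    (hIJ : I ⊆ J) (hIL : ∀ j ∈ I, ∀ l, l + 2 ≤ j → l ∈ L) (h : q + 1 = p)
    {x : (free Z).obj n p} (hx : x ∈ weightSum Δ.piece I n p) :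
    D.d n p q h x - d.d n p q h x ∈ weightSum Δ.piece L n q :=
  (D.sub d.toDerivation).mem_weightSum (isShift_setOf_add_le 2) hJ
    (fun j hj n p q h z hz => (hD j hj n p q h z hz).sub_mem) hIJ hIL h hx

theorem d_d (hD : IsFilteredModelOn Δ ρ D α J) (hJ : IsLowerSet J) (h : q + 1 = p)
    (hr : r + 1 = q) {x : (free Z).obj n p} (hx : x ∈ weightSum Δ.piece J n p) :
    D.d n q r hr (D.d n p q h x) = 0 :=
  D.d_d_eq_zero_of_mem_weightSum hJ
    (fun j hj n p q r h hr z hz => (hD j hj n p q h z hz).d_eq_zero r hr) h hr hx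

theorem map_d (hD : IsFilteredModelOn Δ ρ D α J) (hJ : IsLowerSet J) (h : q + 1 = p)
    {x : (free Z).obj n p} (hx : x ∈ weightSum Δ.piece J n p) :
    α.map n q (D.d n p q h x) = dS.d n p q h (α.map n p x) :=
  α.map_d_of_mem_weightSum D dS.toDerivation hJ
    (fun j hj n p q h z hz => (hD j hj n p q h z hz).map_eq) h hx

theorem map_d_mem_clGraph (hD : IsFilteredModelOn Δ ρ D α J) (hJ : IsLowerSet J) (h : q + 1 = p)
    {x : (free Z).obj n p} (hx : x ∈ weightSum Δ.piece J n p) :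
    (α.map n q (D.d n p q h x), 0) ∈ dS.clGraph n q :=
  (Operad.Differential.mem_clGraph_zero h).2 ⟨_, (hD.map_d hJ h hx).symm⟩

theorem mem_clGraph_of_mem_weightPart_zero (hD : IsFilteredModelOn Δ ρ D α J) (h0 : 0 ∈ J)
    {x : (free Z).obj n p} (hx : x ∈ weightPart Δ.piece 0 n p) :
    (α.map n p x, ρ.map n p x) ∈ dS.clGraph n p := by
  rw [← weightSum_singleton] at hx
  refine weightSum_le_of_closed (J := {0})
    (N := fun n p => (dS.clGraph n p).comap ((α.map n p).prod (ρ.map n p)))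
    (fun a b hba ha => Nat.le_zero.1 (hba.trans_eq ha)) ?_ (fun n p σ x hx => ?_)
    (fun h i p q r hr x hx y hy => ?_) hx
  · rintro _ rfl n p z hz
    exact (hD 0 h0 n p (p - 1) (sub_add_cancel p 1) z hz).mem_clGraph rfl
  · have := Operad.Differential.act_mem_clGraph σ hx
    rwa [← α.map_act, ← ρ.map_act] at this
  · have := Operad.Differential.circ_mem_clGraph h i hr hx hy
    rwa [← α.map_circ, ← ρ.map_circ] at this

end IsFilteredModelOn

namespace IsBigradedResolution

variable (hd : IsBigradedResolution Δ d ρ)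
include hd

theorem perturbation_mem (hD : IsFilteredModelOn Δ ρ D α J) (hJ : IsLowerSet J) (hIJ : K ⊆ J)
    {L : Set ℕ} (hIL : ∀ j ∈ K, ∀ l, l + 1 ≤ j → l ∈ L) (h : q + 1 = p)
    {x : (free Z).obj n p} (hx : x ∈ weightSum Δ.piece K n p) :
    D.d n p q h x ∈ weightSum Δ.piece L n q := by
  have hsub : D.d n p q h x - d.d n p q h x ∈ weightSum Δ.piece L n q :=
    hD.d_sub_d_mem hJ hIJ (fun j hj l hl => hIL j hj l (by omega)) h hx
  have hdx : d.d n p q h x ∈ weightSum Δ.piece L n q :=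
    hd.d_mem h (fun j hj l hl => hIL j hj l hl.le) hx
  exact (Submodule.sub_mem_iff_left _ hdx).1 hsub

theorem perturbation_eq_zero (hD : IsFilteredModelOn Δ ρ D α J) (hJ : IsLowerSet J) (h0 : 0 ∈ J)
    (h : q + 1 = p) {x : (free Z).obj n p} (hx : x ∈ weightPart Δ.piece 0 n p) :
    D.d n p q h x = 0 := by
  rw [← weightSum_singleton] at hx
  have : D.d n p q h x ∈ weightSum Δ.piece ∅ n q :=
    hd.perturbation_mem hD hJ (Set.singleton_subset_iff.2 h0)
      (by rintro _ rfl l hl; exact absurd hl (Nat.not_succ_le_zero l)) h hx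
  rwa [weightSum_empty, Submodule.mem_bot] at this

theorem d_leading_eq_zero [CharZero k] {i : ℕ}
    (hD : IsFilteredModelOn Δ ρ D α (Set.Iic i)) (h : q + 1 = p) {x u : (free Z).obj n p}
    (hu : u ∈ weightPart Δ.piece i n p) (hxu : x - u ∈ weightSum Δ.piece (Set.Iio i) n p)
    (hDx : D.d n p q h x = 0) : d.d n p q h u = 0 := by
  rw [← weightSum_singleton] at hu
  have hdu : d.d n p q h u ∈ weightSum Δ.piece {l | l + 1 = i} n q :=
    hd.d_mem h (by rintro _ rfl l hl; exact hl) hu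
  have hDdu : D.d n p q h u - d.d n p q h u ∈ weightSum Δ.piece {l | l + 2 ≤ i} n q :=
    hD.d_sub_d_mem (isLowerSet_Iic i) (Set.singleton_subset_iff.2 Set.self_mem_Iic)
      (by rintro _ rfl l hl; exact hl) h hu
  have hDxu : D.d n p q h (x - u) ∈ weightSum Δ.piece {l | l + 2 ≤ i} n q :=
    hd.perturbation_mem hD (isLowerSet_Iic i) Set.Iio_subset_Iic_self
      (fun j (hj : j < i) l hl => show l + 2 ≤ i by omega) h hxu
  have hdisj : Disjoint {l | l + 1 = i} {l | l + 2 ≤ i} :=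
    Set.disjoint_left.2 fun l (hl : l + 1 = i) (hl' : l + 2 ≤ i) => by omega
  refine Submodule.disjoint_def.1 (disjoint_weightSum Δ hdisj n q) _ hdu ?_
  have := neg_mem (add_mem hDdu hDxu)
  rwa [map_sub, hDx, zero_sub, ← sub_eq_add_neg, sub_sub_cancel_left, neg_neg] at this

theorem exists_sub_perturbation_mem [CharZero k] (h : q + 1 = p) {i : ℕ}
    (hD : IsFilteredModelOn Δ ρ D α (Set.Iio (i + 2)))
    {x : (free Z).obj n q} (hx : x ∈ weightSum Δ.piece (Set.Iio (i + 1)) n q)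
    (hDx : ∀ r (hr : r + 1 = q), D.d n q r hr x = 0)
    (hαx : (α.map n q x, 0) ∈ dS.clGraph n q) :
    ∃ v ∈ weightSum Δ.piece (Set.Iio (i + 2)) n p,
      x - D.d n p q h v ∈ weightSum Δ.piece (Set.Iio i) n q := by
  obtain ⟨u, hu, hxu⟩ := exists_sub_mem_weightSum_Iio hx
  have hdu (r) (hr : r + 1 = q) : d.d n q r hr u = 0 :=
    hd.d_leading_eq_zero (hD.mono (Set.Iic_subset_Iio.2 (by omega))) hr hu hxu (hDx r hr)
  have hρu : i = 0 → ρ.map n q u = 0 := by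
    rintro rfl
    obtain rfl := sub_eq_zero.1 (eq_zero_of_mem_weightSum_Iio_zero hxu)
    have hρα := sub_mem
      (hD.mem_clGraph_of_mem_weightPart_zero (Set.mem_Iio.2 (Nat.succ_pos _)) hu) hαx
    rw [Prod.mk_sub_mk, sub_self, sub_zero] at hρα
    exact Operad.Differential.eq_zero_of_mem_clGraph hρα
  obtain ⟨v, hv, rfl⟩ := hd.exists_d_eq_of_mem_weightPart h hu hdu hρu
  have hDdv : D.d n p q h v - d.d n p q h v ∈ weightSum Δ.piece (Set.Iio i) n q :=
    hD.d_sub_d_mem (isLowerSet_Iio _)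
      (Set.singleton_subset_iff.2 (Set.mem_Iio.2 (Nat.lt_succ_self _)))
      (by rintro _ rfl l hl; exact Nat.lt_of_succ_lt_succ hl) h
      (weightPart_le_weightSum (Set.mem_singleton _) hv)
  refine ⟨v, weightPart_le_weightSum (Set.mem_Iio.2 (Nat.lt_succ_self _)) hv, ?_⟩
  rw [← sub_sub_sub_cancel_right _ _ (d.d n p q h v)]
  exact sub_mem hxu hDdv

theorem exists_perturbation_eq [CharZero k] (h : q + 1 = p) {i : ℕ}
    (hD : IsFilteredModelOn Δ ρ D α (Set.Iio (i + 1)))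
    {x : (free Z).obj n q} (hx : x ∈ weightSum Δ.piece (Set.Iio i) n q)
    (hDx : ∀ r (hr : r + 1 = q), D.d n q r hr x = 0)
    (hαx : (α.map n q x, 0) ∈ dS.clGraph n q) :
    ∃ y ∈ weightSum Δ.piece (Set.Iio (i + 1)) n p, D.d n p q h y = x := by
  induction i generalizing x with
  | zero => exact ⟨0, zero_mem _, by rw [map_zero, eq_zero_of_mem_weightSum_Iio_zero hx]⟩
  | succ i ih =>
    have hlow := isLowerSet_Iio (i + 2)
    have hle : Set.Iio (i + 1) ⊆ Set.Iio (i + 2) := Set.Iio_subset_Iio (Nat.le_succ _)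
    obtain ⟨v, hv, hxv⟩ := hd.exists_sub_perturbation_mem h hD hx hDx hαx
    have hDxv (r) (hr : r + 1 = q) : D.d n q r hr (x - D.d n p q h v) = 0 := by
      rw [map_sub, hDx r hr, hD.d_d hlow h hr hv, sub_zero]
    have hαxv : (α.map n q (x - D.d n p q h v), 0) ∈ dS.clGraph n q := by
      have hsub := sub_mem hαx (hD.map_d_mem_clGraph hlow h hv)
      rwa [Prod.mk_sub_mk, sub_zero, ← map_sub] at hsub
    obtain ⟨y, hy, hDy⟩ := ih (hD.mono hle) hxv hDxv hαxv
    exact ⟨v + y, add_mem hv (weightSum_mono hle hy), by rw [map_add, hDy, add_sub_cancel]⟩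

theorem mem_weightSum_of_isAdmissibleValue {j : ℕ} {h : q + 1 = p} {z : Z.obj n p}
    (hz : z ∈ Δ.piece j n p) {y : (free Z).obj n q} {s : S.obj n p}
    (hys : IsAdmissibleValue Δ ρ D α j h z y s) : y ∈ weightSum Δ.piece (Set.Iio j) n q := by
  have hdz : d.d n p q h (gen Z n p z) ∈ weightSum Δ.piece (Set.Iio j) n q :=
    weightSum_mono (fun l (hl : l + 1 = j) => Set.mem_Iio.2 (by omega))
      (hd.d_gen_mem h hz)
  have hsub : y - d.d n p q h (gen Z n p z) ∈ weightSum Δ.piece (Set.Iio j) n q :=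
    weightSum_mono (fun l (hl : l + 2 ≤ j) => Set.mem_Iio.2 (by omega)) hys.sub_mem
  exact (Submodule.sub_mem_iff_left _ hdz).1 hsub

theorem exists_isAdmissibleValue_zero (h : q + 1 = p) {z : Z.obj n p} (hz : z ∈ Δ.piece 0 n p) :
    ∃ y s, IsAdmissibleValue Δ ρ D α 0 h z y s := by
  obtain ⟨s, hs⟩ := Operad.Differential.exists_mem_clGraph (ρ.map n p (gen Z n p z))
  exact ⟨0, s,
    { sub_mem := by rw [hd.d_zero n p q h z hz, sub_zero]; exact zero_mem _
      d_eq_zero := fun r hr => map_zero _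
      map_eq := by rw [map_zero, Operad.Differential.d_eq_zero_of_mem_clGraph hs h]
      mem_clGraph := fun _ => hs }⟩

theorem exists_isAdmissibleValue_one (hD : IsFilteredModelOn Δ ρ D α (Set.Iio 1)) (h : q + 1 = p)
    {z : Z.obj n p} (hz : z ∈ Δ.piece 1 n p) : ∃ y s, IsAdmissibleValue Δ ρ D α 1 h z y s := by
  have hdz := hd.d_succ 0 n p q h z hz
  have hρ : ρ.map n q (d.d n p q h (gen Z n p z)) = 0 := ρ.map_d n p q h _
  have hα := hD.mem_clGraph_of_mem_weightPart_zero (Set.mem_Iio.2 Nat.one_pos) hdz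
  rw [hρ] at hα
  obtain ⟨s, hs⟩ := (Operad.Differential.mem_clGraph_zero h).1 hα
  exact ⟨d.d n p q h (gen Z n p z), s,
    { sub_mem := by rw [sub_self]; exact zero_mem _
      d_eq_zero := fun r hr =>
        hd.perturbation_eq_zero hD (isLowerSet_Iio 1) (Set.mem_Iio.2 Nat.one_pos) hr hdz
      map_eq := hs.symm
      mem_clGraph := fun h => absurd h one_ne_zero }⟩

theorem exists_perturbation_sub_eq_zero [CharZero k] {m : ℕ}
    (hD : IsFilteredModelOn Δ ρ D α (Set.Iio (m + 2))) {c : (free Z).obj n q}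
    (hc : c ∈ weightPart Δ.piece (m + 1) n q) (hdc : ∀ r (hr : r + 1 = q), d.d n q r hr c = 0) :
    ∃ y ∈ weightSum Δ.piece (Set.Iio (m + 1)) n q,
      ∀ r (hr : r + 1 = q), D.d n q r hr (c - y) = 0 := by
  have hlow := isLowerSet_Iio (m + 2)
  obtain ⟨r, hr⟩ : ∃ r, r + 1 = q := ⟨q - 1, sub_add_cancel q 1⟩
  have hc' : c ∈ weightSum Δ.piece (Set.Iio (m + 2)) n q :=
    weightPart_le_weightSum (Set.mem_Iio.2 (Nat.lt_succ_self _)) hc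
  have hDc : D.d n q r hr c ∈ weightSum Δ.piece (Set.Iio m) n r := by
    have hDdc : D.d n q r hr c - d.d n q r hr c ∈ weightSum Δ.piece (Set.Iio m) n r :=
      hD.d_sub_d_mem hlow (Set.singleton_subset_iff.2 (Set.mem_Iio.2 (Nat.lt_succ_self _)))
        (by rintro _ rfl l hl; exact Nat.lt_of_succ_lt_succ hl) hr
        (weightPart_le_weightSum (Set.mem_singleton _) hc)
    rwa [hdc, sub_zero] at hDdc
  obtain ⟨y, hy, hDy⟩ := hd.exists_perturbation_eq hr
    (hD.mono (Set.Iio_subset_Iio (Nat.le_succ _))) hDc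
    (fun _ hr' => hD.d_d hlow hr hr' hc') (hD.map_d_mem_clGraph hlow hr hc')
  refine ⟨y, hy, fun r' hr' => ?_⟩
  obtain rfl : r' = r := by omega
  rw [map_sub, hDy, sub_self]

theorem exists_d_eq_map_sub (hD : IsFilteredModelOn Δ ρ D α J) (hJ : IsLowerSet J) (h0 : 0 ∈ J)
    (h : q + 1 = p) {x : (free Z).obj n q} (hx : x ∈ weightSum Δ.piece J n q)
    (hDx : ∀ r (hr : r + 1 = q), D.d n q r hr x = 0) :
    ∃ w ∈ weightPart Δ.piece 0 n q, ∃ s, dS.d n p q h s = α.map n q (x - w) := by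
  have hαx : α.map n q x ∈ dS.cycles n q := dS.mem_cycles.2 fun r hr => by
    rw [← hD.map_d hJ hr hx, hDx, map_zero]
  obtain ⟨w, hw, hρw⟩ := hd.exists_weightPart_zero (dS.cl n q ⟨_, hαx⟩)
  have hα := sub_mem (Operad.Differential.mem_clGraph.2 ⟨hαx, hρw.symm⟩)
    (hD.mem_clGraph_of_mem_weightPart_zero h0 hw)
  rw [Prod.mk_sub_mk, sub_self, ← map_sub, Operad.Differential.mem_clGraph_zero h] at hα
  exact ⟨w, hw, hα⟩

theorem exists_isAdmissibleValue_add_two [CharZero k] {m : ℕ}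
    (hD : IsFilteredModelOn Δ ρ D α (Set.Iio (m + 2))) (h : q + 1 = p) {z : Z.obj n p}
    (hz : z ∈ Δ.piece (m + 2) n p) : ∃ y s, IsAdmissibleValue Δ ρ D α (m + 2) h z y s := by
  have hlow := isLowerSet_Iio (m + 2)
  have hc : d.d n p q h (gen Z n p z) ∈ weightPart Δ.piece (m + 1) n q :=
    hd.d_succ (m + 1) n p q h z hz
  obtain ⟨y, hy, hDcy⟩ := hd.exists_perturbation_sub_eq_zero hD hc fun r hr => d.d_d ..
  have hcy : d.d n p q h (gen Z n p z) - y ∈ weightSum Δ.piece (Set.Iio (m + 2)) n q :=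
    sub_mem (weightPart_le_weightSum (Set.mem_Iio.2 (Nat.lt_succ_self _)) hc)
      (weightSum_mono (Set.Iio_subset_Iio (Nat.le_succ _)) hy)
  obtain ⟨w, hw, s, hs⟩ :=
    hd.exists_d_eq_map_sub hD hlow (Set.mem_Iio.2 (Nat.succ_pos _)) h hcy hDcy
  have hIio : Set.Iio (m + 1) ⊆ {l | l + 2 ≤ m + 2} := fun _ hl =>
    Set.mem_ofPred.2 (Nat.succ_le_succ (Set.mem_Iio.1 hl))
  have hyw : y + w ∈ weightSum Δ.piece {l | l + 2 ≤ m + 2} n q := weightSum_mono hIio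
    (add_mem hy (weightPart_le_weightSum (Set.mem_Iio.2 (Nat.succ_pos m)) hw))
  refine ⟨d.d n p q h (gen Z n p z) - y - w, s, ?_, fun r hr => ?_, hs.symm,
    fun h => absurd h (Nat.succ_ne_zero _)⟩
  · rw [sub_sub _ y w, sub_sub_cancel_left]
    exact neg_mem hyw
  · have hDw : D.d n q r hr w = 0 :=
      hd.perturbation_eq_zero hD hlow (Set.mem_Iio.2 (Nat.succ_pos _)) hr hw
    rw [map_sub, hDcy, hDw, sub_zero]

theorem exists_isAdmissibleValue [CharZero k] {m : ℕ}
    (hD : IsFilteredModelOn Δ ρ D α (Set.Iio m)) (h : q + 1 = p) {z : Z.obj n p}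
    (hz : z ∈ Δ.piece m n p) : ∃ y s, IsAdmissibleValue Δ ρ D α m h z y s :=
  match m with
  | 0 => hd.exists_isAdmissibleValue_zero h hz
  | 1 => hd.exists_isAdmissibleValue_one hD h hz
  | _ + 2 => hd.exists_isAdmissibleValue_add_two hD h hz

end IsBigradedResolution

end FilteredModels

section Construction

variable {k : Type u} [Field k] {Z : Collection.{u, w} k} (Δ : Z.Decomposition)
  (S : Operad.{u, v} k)

/-- The joint values of a derivation of the free operad and of a homomorphism to `S` at the
generators of weight `j`. The value of the homomorphism at a generator of degree `p` is the one for
`q = p - 1`. -/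
abbrev GeneratorValues (j : ℕ) : Type (max u v w) :=
  ∀ n p q, q + 1 = p → IntertwiningMap (Δ.pieceRep n p j).toRepresentation
    (((free Z).act n q).prod (S.act n p))

variable {Δ S}

/-- The derivation of the free operad with the given values at the generators. -/
noncomputable def derivationOfValues (f : ∀ j, GeneratorValues Δ S j) : (free Z).Derivation :=
  freeDerivation fun n p q h => (IntertwiningMap.fst k _ _).comp
    (glue (N := Δ.pieceRep n p) (Δ.isInternal n p) fun j => f j n p q h)

/-- The homomorphism from the free operad with the given values at the generators. -/
noncomputable def homOfValues (f : ∀ j, GeneratorValues Δ S j) : (free Z).Hom S :=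
  freeLift fun n p => (IntertwiningMap.snd k _ _).comp
    (glue (N := Δ.pieceRep n p) (Δ.isInternal n p) fun j => f j n p (p - 1) (sub_add_cancel p 1))

variable {j m n : ℕ} {p q : ℤ} {f g : ∀ j, GeneratorValues Δ S j}

theorem derivationOfValues_gen (h : q + 1 = p) {z : Z.obj n p} (hz : z ∈ Δ.piece j n p) :
    (derivationOfValues f).d n p q h (gen Z n p z) = (f j n p q h ⟨z, hz⟩).1 := by
  rw [derivationOfValues, freeDerivation_gen]
  exact congrArg Prod.fst (glue_apply_of_mem (N := Δ.pieceRep n p) _ _ hz)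

theorem homOfValues_gen {z : Z.obj n p} (hz : z ∈ Δ.piece j n p) :
    (homOfValues f).map n p (gen Z n p z) = (f j n p (p - 1) (sub_add_cancel p 1) ⟨z, hz⟩).2 := by
  rw [homOfValues, freeLift_gen]
  exact congrArg Prod.snd (glue_apply_of_mem (N := Δ.pieceRep n p) _ _ hz)

theorem derivationOfValues_congr (hfg : ∀ j < m, f j = g j) (h : q + 1 = p)
    {x : (free Z).obj n p} (hx : x ∈ weightSum Δ.piece (Set.Iio m) n p) :
    (derivationOfValues f).d n p q h x = (derivationOfValues g).d n p q h x :=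
  (derivationOfValues f).eqOn_weightSum _ (isLowerSet_Iio m) (fun j hj n p q h z hz => by
    rw [derivationOfValues_gen h hz, derivationOfValues_gen h hz, hfg j hj]) h hx

theorem homOfValues_congr (hfg : ∀ j < m, f j = g j)
    {x : (free Z).obj n p} (hx : x ∈ weightSum Δ.piece (Set.Iio m) n p) :
    (homOfValues f).map n p x = (homOfValues g).map n p x :=
  (homOfValues f).eqOn_weightSum _ (isLowerSet_Iio m) (fun j hj n p z hz => by
    rw [homOfValues_gen hz, homOfValues_gen hz, hfg j hj]) hx

variable {dS : S.Differential} {d : (free Z).Differential}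
  {ρ : DGHom d dS.homology.zeroDifferential} (hd : IsBigradedResolution Δ d ρ)

include hd

theorem IsBigradedResolution.isFilteredModelOn_singleton (hfg : ∀ j < m, f j = g j)
    (hg : ∀ n p q h (z : Δ.piece m n p), IsAdmissibleValue Δ ρ (derivationOfValues f)
      (homOfValues f) m h z (g m n p q h z).1 (g m n p q h z).2) :
    IsFilteredModelOn Δ ρ (derivationOfValues g) (homOfValues g) {m} := by
  rintro _ rfl n p q h z hz
  obtain rfl : q = p - 1 := by omega
  have hgz := hg n p (p - 1) h ⟨z, hz⟩
  have hmem := hd.mem_weightSum_of_isAdmissibleValue hz hgz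
  rw [derivationOfValues_gen h hz, homOfValues_gen hz]
  exact
    { sub_mem := hgz.sub_mem
      d_eq_zero := fun r hr =>
        (derivationOfValues_congr hfg hr hmem).symm.trans (hgz.d_eq_zero r hr)
      map_eq := (homOfValues_congr hfg hmem).symm.trans hgz.map_eq
      mem_clGraph := hgz.mem_clGraph }

variable [CharZero k]

theorem IsBigradedResolution.exists_isFilteredModelOn_update
    (hf : ∀ j < m, IsFilteredModelOn Δ ρ (derivationOfValues f) (homOfValues f) {j}) :
    ∃ x, IsFilteredModelOn Δ ρ (derivationOfValues (Function.update f m x))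
      (homOfValues (Function.update f m x)) {m} := by
  have hlt : IsFilteredModelOn Δ ρ (derivationOfValues f) (homOfValues f) (Set.Iio m) :=
    fun j hj => hf j hj j (Set.mem_singleton j)
  have hgraph (n : ℕ) (p q : ℤ) (h : q + 1 = p) := exists_intertwining_graph_le
    (admissibleValues Δ ρ (derivationOfValues f) (homOfValues f) m (n := n) h) fun z =>
      let ⟨y, s, hys⟩ := hd.exists_isAdmissibleValue hlt h z.2
      ⟨(y, s), hys⟩
  choose x hx using hgraph
  refine ⟨x, hd.isFilteredModelOn_singleton (f := f)
    (fun j hj => (Function.update_of_ne hj.ne _ _).symm) fun n p q h z => ?_⟩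
  rw [Function.update_self]
  exact hx n p q h z

theorem IsBigradedResolution.exists_isFilteredModelOn_univ :
    ∃ (D : (free Z).Derivation) (α : (free Z).Hom S), IsFilteredModelOn Δ ρ D α Set.univ := by
  obtain ⟨f, hf⟩ := exists_forall_of_update (X := GeneratorValues Δ S)
    (P := fun m f => IsFilteredModelOn Δ ρ (derivationOfValues f) (homOfValues f) {m})
    (fun m f g hfg hf => hd.isFilteredModelOn_singleton (fun j hj => hfg j hj.le)
      fun n p q h z => by
        have hz := hf m (Set.mem_singleton m) n p q h z z.2
        obtain rfl : q = p - 1 := by omega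
        rwa [derivationOfValues_gen h z.2, homOfValues_gen z.2, hfg m le_rfl] at hz)
    (fun m f hf => hd.exists_isFilteredModelOn_update hf)
  exact ⟨_, _, fun j _ => hf j j (Set.mem_singleton j)⟩

theorem IsBigradedResolution.homologyHom_bijective {D : (free Z).Differential} {α : DGHom D dS}
    (hD : IsFilteredModelOn Δ ρ D.toDerivation α.toHom Set.univ) (n : ℕ) (p : ℤ) :
    Function.Bijective (α.homologyHom.map n p) := by
  constructor
  · refine Operad.Differential.homologyHom_injective α rfl fun x hx hαx => ?_
    obtain ⟨m, hm⟩ := exists_mem_weightSum_Iio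
      (fun n p => (Δ.isInternal n p).submodule_iSup_eq_top) x
    obtain ⟨y, -, hy⟩ := hd.exists_perturbation_eq rfl (hD.mono (Set.subset_univ _)) hm hx hαx
    exact ⟨y, hy⟩
  · refine Operad.Differential.homologyHom_surjective α fun c => ?_
    obtain ⟨x, hx, rfl⟩ := hd.exists_weightPart_zero c
    exact ⟨x, fun q h => hd.perturbation_eq_zero hD isLowerSet_univ (Set.mem_univ 0) h hx,
      hD.mem_clGraph_of_mem_weightPart_zero (Set.mem_univ 0) hx⟩

end Construction
end OperadModels

open OperadModels

theorem mainTheorem5_general {k : Type u} [Field k] [CharZero k] {S : Operad.{u, v} k}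
    {dS : S.Differential} {Z : Collection.{u, w} k} {Δ : Z.Decomposition}
    {d : (free Z).Differential} {ρ : DGHom d dS.homology.zeroDifferential}
    (hd : IsBigradedResolution Δ d ρ) :
    ∃ (D : (free Z).Differential) (α : DGHom D dS),
      (∀ j n p q (h : q + 1 = p), ∀ z ∈ Δ.piece j n p,
        D.d n p q h (gen Z n p z) - d.d n p q h (gen Z n p z) ∈
          ⨆ l : ℕ, ⨆ _ : l + 2 ≤ j, tjPart Δ l n q) ∧
      ∀ n p, Function.Bijective (α.homologyHom.map n p) := by
  obtain ⟨D, α, hD⟩ := hd.exists_isFilteredModelOn_univ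
  have mem_univ {n p} (x : (free Z).obj n p) : x ∈ weightSum Δ.piece Set.univ n p :=
    (weightSum_univ_eq_top Δ n p).ge Submodule.mem_top
  let D' := D.toDifferential fun n p q r h hr x => hD.d_d isLowerSet_univ h hr (mem_univ x)
  let α' : DGHom D' dS :=
    { α with map_d := fun n p q h x => hD.map_d isLowerSet_univ h (mem_univ x) }
  exact ⟨D', α', fun j n p q h z hz => (hD j (Set.mem_univ j) n p q h z hz).sub_mem,
    hd.homologyHom_bijective (α := α') hD⟩

theorem mainTheorem5 {k : Type u} [Field k] [CharZero k] (S : Operad.{u, v} k)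
    (hS : S.Reduced) (dS : S.Differential) (M : TJModel.{u, v, w} dS.homology) :
    ∃ (D : (free M.Z).Differential) (α : DGHom D dS),
      (∀ j n p q (h : q + 1 = p), ∀ z ∈ M.dec.piece j n p,
        D.d n p q h (gen M.Z n p z) - M.d.d n p q h (gen M.Z n p z) ∈
          ⨆ l : ℕ, ⨆ _ : l + 2 ≤ j, tjPart M.dec l n q) ∧
      ∀ n p, Function.Bijective (α.homologyHom.map n p) :=
  mainTheorem5_general M.isBigradedResolution
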